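/- Let $\nu\in\mathbb N$, $k\ge 1$, let $\mathbb Z^\nu$ carry the distance $d(x,y)=\max_j|x_j-y_j|$, put $\mathcal A_\Lambda=\bigotimes_{x\in\Lambda}\mathbb M_k(\mathbb C)$ for finite $\Lambda\subset\mathbb Z^\nu$, and let $\mathcal A$ be the quasi-local algebra, i.e. the norm completion of $\mathcal A^{\rm loc}=\bigcup_\Lambda\mathcal A_\Lambda$, with translation automorphisms $\tau_x$. Let $F:[0,\infty)\to(0,\infty)$ be an $F$-function: $F$ is non-increasing, $\sup_x\sum_y F(d(x,y))<\infty$, and there is $C_F>0$ with $\sum_z F(d(x,z))F(d(z,y))\le C_F F(d(x,y))$ for all $x,y$. Let $(\Omega,\mathcal F,\mathbb P)$ be a probability space and let $\mathfrak h$ be an ergodic interaction. That is, $\mathfrak h$ assigns to each $\omega\in\Omega$ and each finite $Z\subset\mathbb Z^\nu$ an element $\mathfrak h(\omega,Z)\in\mathcal A$ such that: for each $Z$, $\mathfrak h(\omega,Z)=\mathfrak h(\omega,Z)^*\in\mathcal A_Z$ for a.e. $\omega$; $\omega\mapsto\varphi(\mathfrak h(\omega,Z))$ is measurable for every $\varphi\in\mathcal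 A^*$; and there is an ergodic action $(\vartheta_x)_{x\in\mathbb Z^\nu}$ of $\mathbb Z^\nu$ on $\Omega$ by measurable measure-preserving maps with $\tau_x(\mathfrak h(\omega,Z))=\mathfrak h(\vartheta_x\omega,Z+x)$ for all $x,Z$ and a.e. $\omega$. Put $$\mathcal N(\omega)=\sup_{x,y}\ \sum_{Z\ni x,y}\frac{\|\mathfrak h(\omega,Z)\|}{F(d(x,y))}\in[0,\infty],\qquad H^\Lambda_\omega=\sum_{Z\subset\Lambda}\mathfrak h(\omega,Z),\qquad \alpha^\Lambda_{t;\omega}(a)=e^{itH^\Lambda_\omega}\,a\,e^{-itH^\Lambda_\omega}.$$ A state $\varphi$ on $\mathcal A$ is called a ground state of a dynamics $\alpha$ on a subalgebra $\mathcal B\subset\mathcal A$ if $-i\varphi(a^*\delta(a))\ge 0$ for all $a\in\mathcal B$ in the domain of the generator $\delta=\frac{d}{dt}\alpha_t|_{t=0}$. Let $(\Lambda_n)$ be an increasing sequence of finite sets with $\bigcup_n\Lambda_n=\mathbb Z^\nu$. (1) Let $\omega\in\Omega$ be such that $\mathfrak h(\omega,Z)=\mathfrak h(\omega,Z)^*\in\mathcal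 A_Z$ for all $Z$ (which holds for a.e. $\omega$) and $\mathcal N(\omega)<\infty$. For each $n$ let $\lambda^{(n)}_\omega$ be a state on $\mathcal A$ that is a ground state of $\alpha^{\Lambda_n}_{t;\omega}$ on $\mathcal A_{\Lambda_n}$. Let $\varphi$ be any weak-$*$ limit point of $(\lambda^{(n)}_\omega)_n$. Then $\varphi$ is a state; the infinite-volume dynamics $\alpha_{t;\omega}$ exists, that is, there is a strongly continuous one-parameter group of $*$-automorphisms of $\mathcal A$ such that $\alpha_{t;\omega}(a)$ is the norm limit of $\alpha^{\Lambda}_{t;\omega}(a)$ as $\Lambda\uparrow\mathbb Z^\nu$ for $a\in\mathcal A^{\rm loc}$; and $\varphi$ is a ground state of $\alpha_{t;\omega}$ on $\mathcal A$. In particular, for all finite $X$ and $a\in\mathcal A_X$ the series $\delta_\omega(a)=\sum_{Z\cap X\ne\emptyset}[i\mathfrak h(\omega,Z),a]$ converges and $-i\varphi(a^*\delta_\omega(a))\ge 0$. (2) Suppose in addition that $\mathbb P[\mathcal N<\infty]>0$. A disordered ground state is a map $\Gamma$ from $\Omega$ to the states of $\mathcal A$ such that $\omega\mapsto\Gamma_\omega(a)$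 is measurable for every $a\in\mathcal A$ and, for a.e. $\omega$, for all finite $X$ and $a\in\mathcal A_X$ the series $\delta_\omega(a)$ converges and $-i\Gamma_\omega(a^*\delta_\omega(a))\ge 0$. If $\lambda^{(n)}:\Omega\to\mathcal A^*$ are weak-$*$ measurable and, for each $n$ and a.e. $\omega$, $\lambda^{(n)}_\omega$ is a state that is a ground state of $\alpha^{\Lambda_n}_{t;\omega}$ on $\mathcal A_{\Lambda_n}$, then there are a disordered ground state $\Gamma$ and measurable $\sigma_n:\Omega\to\mathbb N$ such that for a.e. $\omega$ the sequence $\sigma_n(\omega)$ is strictly increasing, $\lambda^{(\sigma_n(\omega))}_\omega\to\Gamma_\omega$ in the weak-$*$ topology, and $\Gamma_\omega$ is a ground state of $\alpha_{t;\omega}$ on $\mathcal A$. In particular, there exists a disordered ground state $\Gamma$ such that, for a.e. $\omega$, $\Gamma_\omega$ is a ground state of $\alpha_{t;\omega}$ on $\mathcal A$. -/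

import Mathlib

open Filter Topology MeasureTheory Complex
open scoped ENNReal ComplexOrder

noncomputable section

namespace QuantumSpin

/-! ### The lattice, configurations and operators on the space of configurations -/

/-- The lattice `ℤ^ν`. Its distance is the sup-distance `max_j |x_j - y_j|`. -/
abbrev Site (ν : ℕ) : Type := Fin ν → ℤ

/-- Classical configurations of `k`-level spins on the lattice. -/
abbrev Config (ν k : ℕ) : Type := Site ν → Fin k

/-- Classical configurations in the finite volume `Λ`. They label the standard basis of
`⨂_{x ∈ Λ} ℂ^k`. -/
abbrev LocalConfig {ν : ℕ} (k : ℕ) (Λ : Finset (Site ν)) : Type := Λ → Fin k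

/-- The Hilbert space `ℓ²(Config)`. The quasi-local algebra, the unique `C^*`-completion of the
union of the matrix algebras `⨂_{x ∈ Λ} M_k(ℂ)`, is realised below as a norm-closed algebra of
operators on it, on which every matrix algebra acts faithfully (hence isometrically). -/
abbrev ConfigSpace (ν k : ℕ) : Type := lp (fun _ : Config ν k => ℂ) 2

/-- Bounded operators on `ℓ²(Config)`. -/
abbrev ConfigOp (ν k : ℕ) : Type := ConfigSpace ν k →L[ℂ] ConfigSpace ν k

variable {ν k : ℕ}

theorem memℓp_weightedPerm (c : Config ν k → ℂ) (hc : ∀ s, ‖c s‖ ≤ 1)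
    (e : Equiv.Perm (Config ν k)) (ψ : ConfigSpace ν k) :
    Memℓp (fun s => c s * ψ (e s)) 2 := by
  have h2 : (0 : ℝ) < (2 : ℝ≥0∞).toReal := by norm_num
  have h1 := e.summable_iff.mpr ((lp.memℓp ψ).summable h2)
  refine memℓp_gen (Summable.of_nonneg_of_le (fun s => by positivity) (fun s => ?_) h1)
  simp only [Function.comp]
  refine Real.rpow_le_rpow (norm_nonneg _) ?_ h2.le
  rw [norm_mul]
  exact mul_le_of_le_one_left (norm_nonneg _) (hc s)

/-- The bounded operator `(T ψ)(s) = c(s) ψ(e s)` on `ℓ²(Config)`. -/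
def weightedPerm (c : Config ν k → ℂ) (hc : ∀ s, ‖c s‖ ≤ 1)
    (e : Equiv.Perm (Config ν k)) : ConfigOp ν k :=
  LinearMap.mkContinuous
    { toFun := fun ψ => ⟨fun s => c s * ψ (e s), memℓp_weightedPerm c hc e ψ⟩
      map_add' := fun ψ φ => by
        ext s
        exact mul_add (c s) (ψ (e s)) (φ (e s))
      map_smul' := fun z ψ => by
        ext s
        simp [mul_left_comm] } 1 (fun ψ => by
    have h2 : (0 : ℝ) < (2 : ℝ≥0∞).toReal := by norm_num
    rw [one_mul]
    refine lp.norm_le_of_tsum_le h2 (norm_nonneg _) ?_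
    rw [lp.norm_rpow_eq_tsum h2 ψ, ← e.tsum_eq (fun s => ‖ψ s‖ ^ (2 : ℝ≥0∞).toReal)]
    refine Summable.tsum_le_tsum (fun s => ?_)
      ((memℓp_weightedPerm c hc e ψ).summable h2)
      (e.summable_iff.mpr ((lp.memℓp ψ).summable h2))
    refine Real.rpow_le_rpow (norm_nonneg _) ?_ h2.le
    show ‖c s * ψ (e s)‖ ≤ _
    rw [norm_mul]
    exact mul_le_of_le_one_left (norm_nonneg _) (hc s))

@[simp] theorem weightedPerm_apply (c : Config ν k → ℂ) (hc : ∀ s, ‖c s‖ ≤ 1)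
    (e : Equiv.Perm (Config ν k)) (ψ : ConfigSpace ν k) (s : Config ν k) :
    weightedPerm c hc e ψ s = c s * ψ (e s) := rfl

theorem star_weightedPerm (c d : Config ν k → ℂ) (hc : ∀ s, ‖c s‖ ≤ 1) (hd : ∀ s, ‖d s‖ ≤ 1)
    (e : Equiv.Perm (Config ν k)) (h : ∀ s, d (e s) = star (c s)) :
    star (weightedPerm c hc e) = weightedPerm d hd e.symm := by
  rw [ContinuousLinearMap.star_eq_adjoint]
  symm
  rw [ContinuousLinearMap.eq_adjoint_iff]
  intro ψ φ
  rw [lp.inner_eq_tsum, lp.inner_eq_tsum, ← e.tsum_eq]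
  refine tsum_congr (fun s => ?_)
  simp [h s]
  ring

/-! ### Local observables -/

/-- Restriction of a configuration to `Λ`. -/
def restr (Λ : Finset (Site ν)) (s : Config ν k) : LocalConfig k Λ := fun x => s x

/-- The configuration that is `u` inside `Λ` and `s` outside. -/
def overwrite (Λ : Finset (Site ν)) (u : LocalConfig k Λ) (s : Config ν k) : Config ν k :=
  fun x => if hx : x ∈ Λ then u ⟨x, hx⟩ else s x

@[simp] theorem restr_overwrite (Λ : Finset (Site ν)) (u : LocalConfig k Λ) (s : Config ν k) :
    restr Λ (overwrite Λ u s) = u := by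
  funext x
  simp [restr, overwrite]

@[simp] theorem overwrite_overwrite (Λ : Finset (Site ν)) (u v : LocalConfig k Λ)
    (s : Config ν k) : overwrite Λ u (overwrite Λ v s) = overwrite Λ u s := by
  funext x
  by_cases hx : x ∈ Λ <;> simp [overwrite, hx]

@[simp] theorem overwrite_restr (Λ : Finset (Site ν)) (s : Config ν k) :
    overwrite Λ (restr Λ s) s = s := by
  funext x
  by_cases hx : x ∈ Λ <;> simp [restr, overwrite, hx]

/-- Interchange of the local configurations `u` and `v` in `Λ`. -/
def swapIn (Λ : Finset (Site ν)) (u v : LocalConfig k Λ) : Equiv.Perm (Config ν k) :=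
  Function.Involutive.toPerm (fun s => overwrite Λ (Equiv.swap u v (restr Λ s)) s)
    (fun s => by simp)

theorem swapIn_apply (Λ : Finset (Site ν)) (u v : LocalConfig k Λ) (s : Config ν k) :
    swapIn Λ u v s = overwrite Λ (Equiv.swap u v (restr Λ s)) s := rfl

/-- The matrix unit `|u⟩⟨v| ⊗ 1` acting on `ℓ²(Config)`. -/
def matrixUnit (Λ : Finset (Site ν)) (u v : LocalConfig k Λ) : ConfigOp ν k :=
  weightedPerm (fun s => if restr Λ s = u then 1 else 0) (fun s => by split_ifs <;> simp)
    (swapIn Λ u v)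

theorem matrixUnit_apply (Λ : Finset (Site ν)) (u v : LocalConfig k Λ) (ψ : ConfigSpace ν k)
    (s : Config ν k) :
    matrixUnit Λ u v ψ s = if restr Λ s = u then ψ (overwrite Λ v s) else 0 := by
  rw [matrixUnit, weightedPerm_apply, swapIn_apply]
  split_ifs with h <;> simp [h]

theorem star_matrixUnit (Λ : Finset (Site ν)) (u v : LocalConfig k Λ) :
    star (matrixUnit Λ u v) = matrixUnit Λ v u := by
  rw [matrixUnit, star_weightedPerm _ (fun s => if restr Λ s = v then 1 else 0) _
    (fun s => by split_ifs <;> simp) _ (fun s => ?_)]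
  · ext ψ s
    rw [matrixUnit_apply, weightedPerm_apply]
    split_ifs with h
    · rw [one_mul]
      have hs : (swapIn Λ u v).symm = swapIn Λ u v := Function.Involutive.toPerm_symm _
      rw [hs, swapIn_apply, h, Equiv.swap_apply_right]
    · simp
  · rw [swapIn_apply, restr_overwrite]
    have : (Equiv.swap u v (restr Λ s) = v) ↔ restr Λ s = u := by
      rw [Equiv.swap_apply_eq_iff, Equiv.swap_apply_right]
    simp only [this]
    split_ifs <;> simp

/-- The operator `m ⊗ 1` on `ℓ²(Config)` of a matrix `m ∈ ⨂_{x ∈ Λ} M_k(ℂ)`. -/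
def localOp (Λ : Finset (Site ν)) (m : Matrix (LocalConfig k Λ) (LocalConfig k Λ) ℂ) :
    ConfigOp ν k :=
  ∑ u, ∑ v, m u v • matrixUnit Λ u v

theorem localOp_apply (Λ : Finset (Site ν)) (m : Matrix (LocalConfig k Λ) (LocalConfig k Λ) ℂ)
    (ψ : ConfigSpace ν k) (s : Config ν k) :
    localOp Λ m ψ s = ∑ v, m (restr Λ s) v * ψ (overwrite Λ v s) := by
  simp only [localOp, sum_apply, smul_apply, lp.coeFn_sum, lp.coeFn_smul, Finset.sum_apply, Pi.smul_apply, matrixUnit_apply, smul_eq_mul]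
  rw [Finset.sum_eq_single (restr Λ s)]
  · simp
  · intro u _ hu
    simp [hu.symm]
  · simp

/-- The representation `m ↦ m ⊗ 1` of `⨂_{x ∈ Λ} M_k(ℂ)`, realised as the algebra of matrices
indexed by the local configurations in `Λ`, on `ℓ²(Config)`. It is faithful
(`localRep_injective`) and compatible with the inclusions of volumes (`localRep_embed`). -/
def localRep (Λ : Finset (Site ν)) :
    Matrix (LocalConfig k Λ) (LocalConfig k Λ) ℂ →⋆ₐ[ℂ] ConfigOp ν k where
  toFun := localOp Λ
  map_one' := by
    ext ψ s
    rw [localOp_apply, Finset.sum_eq_single (restr Λ s)]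
    · simp
    · intro u _ hu
      simp [Matrix.one_apply_ne hu.symm]
    · simp
  map_mul' a b := by
    ext ψ s
    simp only [mul_apply_eq_comp, localOp_apply, Matrix.mul_apply, restr_overwrite,
      overwrite_overwrite, Finset.sum_mul, Finset.mul_sum]
    rw [Finset.sum_comm]
    simp only [mul_assoc]
  map_zero' := by
    ext ψ s
    simp [localOp_apply]
  map_add' a b := by
    ext ψ s
    simp [localOp_apply, add_mul, Finset.sum_add_distrib]
  commutes' r := by
    ext ψ s
    rw [localOp_apply, Finset.sum_eq_single (restr Λ s)]
    · simp [Matrix.algebraMap_matrix_apply, Algebra.algebraMap_eq_smul_one]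
    · intro u _ hu
      simp [Matrix.algebraMap_matrix_apply, hu.symm]
    · simp
  map_star' m := by
    simp only [localOp, star_sum, star_smul, star_matrixUnit, Matrix.star_apply]
    rw [Finset.sum_comm]

theorem localRep_apply (Λ : Finset (Site ν)) (m : Matrix (LocalConfig k Λ) (LocalConfig k Λ) ℂ)
    (ψ : ConfigSpace ν k) (s : Config ν k) :
    localRep Λ m ψ s = ∑ v, m (restr Λ s) v * ψ (overwrite Λ v s) :=
  localOp_apply Λ m ψ s

theorem localRep_injective [NeZero k] (Λ : Finset (Site ν)) :
    Function.Injective (localRep (k := k) Λ) := by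
  classical
  intro a b hab
  ext u v
  let s : Config ν k := fun _ => 0
  have h := congrArg (fun T : ConfigOp ν k =>
    T (lp.single 2 (overwrite Λ v s) (1 : ℂ)) (overwrite Λ u s)) hab
  have key : ∀ w : LocalConfig k Λ, (overwrite Λ w s = overwrite Λ v s) ↔ w = v := fun w =>
    ⟨fun e => by simpa using congrArg (restr Λ) e, fun e => by rw [e]⟩
  simpa [localRep_apply, lp.single_apply, Pi.single_apply, key] using h

/-- The inclusion `m ↦ m ⊗ 1_{Λ \ Λ₀}` of the matrices over `Λ₀` into those over `Λ ⊇ Λ₀`. -/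
def embed {Λ₀ Λ : Finset (Site ν)} (hsub : Λ₀ ⊆ Λ)
    (m : Matrix (LocalConfig k Λ₀) (LocalConfig k Λ₀) ℂ) :
    Matrix (LocalConfig k Λ) (LocalConfig k Λ) ℂ :=
  open Classical in
  fun u v => if ∀ x : Λ, (x : Site ν) ∉ Λ₀ → u x = v x then
    m (fun x => u ⟨x, hsub x.2⟩) (fun x => v ⟨x, hsub x.2⟩) else 0

theorem localRep_embed {Λ₀ Λ : Finset (Site ν)} (hsub : Λ₀ ⊆ Λ)
    (m : Matrix (LocalConfig k Λ₀) (LocalConfig k Λ₀) ℂ) :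
    localRep Λ (embed hsub m) = localRep Λ₀ m := by
  classical
  ext ψ s
  rw [localRep_apply, localRep_apply]
  simp only [embed, ite_mul, zero_mul]
  rw [← Finset.sum_filter]
  refine Finset.sum_nbij' (fun v x => v ⟨x, hsub x.2⟩) (fun w => restr Λ (overwrite Λ₀ w s))
    (fun _ _ => Finset.mem_univ _) (fun w _ => ?_) (fun v hv => ?_) (fun w _ => ?_)
    (fun v hv => ?_)
  · simp only [Finset.mem_filter, Finset.mem_univ, true_and]
    intro x hx
    simp [restr, overwrite, hx]
  · simp only [Finset.mem_filter, Finset.mem_univ, true_and] at hv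
    funext x
    by_cases hx : (x : Site ν) ∈ Λ₀
    · simp [restr, overwrite, hx]
    · simp [restr, overwrite, hx, ← hv x hx]
  · funext x
    simp [restr, overwrite]
  · simp only [Finset.mem_filter, Finset.mem_univ, true_and] at hv
    refine congrArg₂ (· * ·) rfl (congrArg (ψ : Config ν k → ℂ) ?_)
    funext x
    by_cases hx : x ∈ Λ
    · by_cases hx0 : x ∈ Λ₀
      · simp [overwrite, hx, hx0]
      · simp [overwrite, hx, hx0, ← hv ⟨x, hx⟩ hx0, restr]
    · have hx0 : x ∉ Λ₀ := fun h => hx (hsub h)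
      simp [overwrite, hx, hx0]

/-- The local algebra `𝒜_Λ = ⨂_{x ∈ Λ} M_k(ℂ)` as an algebra of operators on `ℓ²(Config)`. -/
def localOpAlgebra (ν k : ℕ) (Λ : Finset (Site ν)) : StarSubalgebra ℂ (ConfigOp ν k) :=
  (localRep Λ).range

theorem mem_localOpAlgebra {Λ : Finset (Site ν)} {T : ConfigOp ν k} :
    T ∈ localOpAlgebra ν k Λ ↔ ∃ m, localRep Λ m = T := Iff.rfl

theorem localOpAlgebra_mono {Λ₀ Λ : Finset (Site ν)} (hsub : Λ₀ ⊆ Λ) :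
    localOpAlgebra ν k Λ₀ ≤ localOpAlgebra ν k Λ := by
  rintro T ⟨m, rfl⟩
  exact ⟨embed hsub m, localRep_embed hsub m⟩

/-- The algebra `⋃_Λ 𝒜_Λ` of all local observables, as operators on `ℓ²(Config)`. -/
def locOpAlgebra (ν k : ℕ) : StarSubalgebra ℂ (ConfigOp ν k) where
  carrier := ⋃ Λ : Finset (Site ν), (localOpAlgebra ν k Λ : Set (ConfigOp ν k))
  mul_mem' := by
    classical
    simp only [Set.mem_iUnion, SetLike.mem_coe]
    rintro a b ⟨X, ha⟩ ⟨Y, hb⟩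
    exact ⟨X ∪ Y, mul_mem (localOpAlgebra_mono Finset.subset_union_left ha)
      (localOpAlgebra_mono Finset.subset_union_right hb)⟩
  add_mem' := by
    classical
    simp only [Set.mem_iUnion, SetLike.mem_coe]
    rintro a b ⟨X, ha⟩ ⟨Y, hb⟩
    exact ⟨X ∪ Y, add_mem (localOpAlgebra_mono Finset.subset_union_left ha)
      (localOpAlgebra_mono Finset.subset_union_right hb)⟩
  algebraMap_mem' r := Set.mem_iUnion.mpr ⟨∅, algebraMap_mem (localOpAlgebra ν k ∅) r⟩
  star_mem' := by
    simp only [Set.mem_iUnion, SetLike.mem_coe]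
    rintro a ⟨X, ha⟩
    exact ⟨X, star_mem ha⟩

/-- The quasi-local algebra `𝒜`: the norm closure of the union of the local algebras. -/
def quasiLocal (ν k : ℕ) : StarSubalgebra ℂ (ConfigOp ν k) :=
  (locOpAlgebra ν k).topologicalClosure

/-- The elements of the quasi-local algebra. -/
abbrev Obs (ν k : ℕ) : Type := quasiLocal ν k

/-- The local algebra `𝒜_Λ` as a subalgebra of the quasi-local algebra. -/
def localAlgebra (ν k : ℕ) (Λ : Finset (Site ν)) : StarSubalgebra ℂ (Obs ν k) :=
  (localOpAlgebra ν k Λ).comap (quasiLocal ν k).subtype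

/-! ### Translations -/

/-- Translation `τ_x(Z) = {z + x : z ∈ Z}` of finite volumes. -/
def translateVol (x : Site ν) (Z : Finset (Site ν)) : Finset (Site ν) :=
  Z.map (addRightEmbedding x)

theorem add_mem_translateVol {x y : Site ν} {Z : Finset (Site ν)} :
    y + x ∈ translateVol x Z ↔ y ∈ Z := by
  simp [translateVol]

/-- The permutation `s ↦ s(· + x)` of the configurations. -/
def shiftConfig (x : Site ν) : Equiv.Perm (Config ν k) where
  toFun s := fun y => s (y + x)
  invFun s := fun y => s (y - x)
  left_inv s := by funext y; simp
  right_inv s := by funext y; simp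

/-- The unitary `(U_x ψ)(s) = ψ(s(· + x))` on `ℓ²(Config)`. -/
def shiftUnitary (x : Site ν) : unitary (ConfigOp ν k) :=
  ⟨weightedPerm (fun _ => 1) (by simp) (shiftConfig x), by
    rw [Unitary.mem_iff, star_weightedPerm (fun _ => 1) (fun _ => 1) (by simp) (by simp) _
      (by simp)]
    constructor <;> · ext ψ s; simp⟩

/-- Translation of operators, `T ↦ U_x T U_x^*`. -/
def translateOp (x : Site ν) : ConfigOp ν k ≃⋆ₐ[ℂ] ConfigOp ν k :=
  Unitary.conjStarAlgAut ℂ (ConfigOp ν k) (shiftUnitary x)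

theorem translateOp_apply (x : Site ν) (T : ConfigOp ν k) (ψ : ConfigSpace ν k)
    (s : Config ν k) :
    translateOp x T ψ s =
      T (weightedPerm (fun _ => 1) (by simp) (shiftConfig x).symm ψ) (shiftConfig x s) := by
  have h : (star (shiftUnitary (k := k) x) : ConfigOp ν k)
      = weightedPerm (fun _ => 1) (by simp) (shiftConfig x).symm :=
    star_weightedPerm (fun _ => 1) (fun _ => 1) (by simp) (by simp) _ (by simp)
  rw [translateOp, Unitary.conjStarAlgAut_apply, h, mul_apply_eq_comp, mul_apply_eq_comp]
  simp [shiftUnitary]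

/-- The local configuration `y ↦ u(y + x)` in `Λ` obtained from one in `τ_x(Λ)`. -/
def pullConfig (x : Site ν) (Λ : Finset (Site ν)) (u : LocalConfig k (translateVol x Λ)) :
    LocalConfig k Λ :=
  fun y => u ⟨y + x, add_mem_translateVol.mpr y.2⟩

/-- Translation by `x` moves the matrix at each site `y` of `Λ` to the site `y + x`. -/
theorem translateOp_localRep (x : Site ν) (Λ : Finset (Site ν))
    (m : Matrix (LocalConfig k Λ) (LocalConfig k Λ) ℂ) :
    translateOp x (localRep Λ m) = localRep (translateVol x Λ)
      (m.submatrix (pullConfig x Λ) (pullConfig x Λ)) := by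
  classical
  ext ψ s
  rw [translateOp_apply, localRep_apply, localRep_apply]
  have hm : ∀ z : translateVol x Λ, (z : Site ν) - x ∈ Λ := fun z =>
    add_mem_translateVol.mp (by rw [sub_add_cancel]; exact z.2)
  refine Finset.sum_nbij' (fun v z => v ⟨z - x, hm z⟩)
    (pullConfig x Λ)
    (fun _ _ => Finset.mem_univ _) (fun _ _ => Finset.mem_univ _)
    (fun v _ => ?_) (fun w _ => ?_) (fun v _ => ?_)
  · funext y
    simp [pullConfig]
  · funext z
    simp [pullConfig]
  · rw [weightedPerm_apply, one_mul, Matrix.submatrix_apply]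
    refine congrArg₂ (· * ·) (congrArg₂ m ?_ ?_) (congrArg (ψ : Config ν k → ℂ) ?_)
    · funext y
      simp [pullConfig, restr, shiftConfig]
    · funext y
      simp [pullConfig]
    · funext z
      have hz : z - x ∈ Λ ↔ z ∈ translateVol x Λ := by
        rw [← add_mem_translateVol (x := x), sub_add_cancel]
      by_cases h : z ∈ translateVol x Λ
      · simp [shiftConfig, overwrite, h, hz]
      · simp [shiftConfig, overwrite, h, hz]

theorem translateOp_mem (x : Site ν) {T : ConfigOp ν k} (hT : T ∈ quasiLocal ν k) :
    translateOp x T ∈ quasiLocal ν k := by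
  have hc : Continuous (translateOp (k := k) x) := by
    have : (translateOp (k := k) x : ConfigOp ν k → ConfigOp ν k) = fun T =>
        (shiftUnitary (k := k) x : ConfigOp ν k) * T *
          star (shiftUnitary (k := k) x : ConfigOp ν k) := by
      funext T
      rw [translateOp, Unitary.conjStarAlgAut_apply]
    rw [this]
    fun_prop
  refine map_mem_closure hc hT ?_
  intro S hS
  obtain ⟨Λ, hΛ⟩ := Set.mem_iUnion.mp hS
  obtain ⟨m, rfl⟩ := mem_localOpAlgebra.mp hΛ
  refine Set.mem_iUnion.mpr ⟨translateVol x Λ, ?_⟩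
  rw [translateOp_localRep]
  exact mem_localOpAlgebra.mpr ⟨_, rfl⟩

/-- The translation automorphisms `τ_x` of the quasi-local algebra. -/
def translate (x : Site ν) : Obs ν k →⋆ₐ[ℂ] Obs ν k :=
  StarAlgHom.codRestrict
    (((translateOp x).toStarAlgHom).comp (quasiLocal ν k).subtype)
    (quasiLocal ν k) (fun a => translateOp_mem x a.2)

/-! ### Interactions and local dynamics -/

/-- A (deterministic) interaction: `Φ(Z) = Φ(Z)^* ∈ 𝒜_Z` for all finite `Z`. -/
def IsInteraction (Φ : Finset (Site ν) → Obs ν k) : Prop :=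
  ∀ Z, IsSelfAdjoint (Φ Z) ∧ Φ Z ∈ localAlgebra ν k Z

/-- The local Hamiltonian `H^Λ = ∑_{Z ⊆ Λ} Φ(Z)`. -/
def hamiltonian (Φ : Finset (Site ν) → Obs ν k) (Λ : Finset (Site ν)) : Obs ν k :=
  ∑ Z ∈ Λ.powerset, Φ Z

/-- The propagator `U^Λ(t) = exp(-i t H^Λ)`. -/
def propagator (Φ : Finset (Site ν) → Obs ν k) (Λ : Finset (Site ν)) (t : ℝ) : Obs ν k :=
  NormedSpace.exp ((-(I * (t : ℂ))) • hamiltonian Φ Λ)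

/-- The Heisenberg dynamics `α^Λ_t(a) = U^Λ(-t) a U^Λ(t)`. -/
def localDynamics (Φ : Finset (Site ν) → Obs ν k) (Λ : Finset (Site ν)) (t : ℝ)
    (a : Obs ν k) : Obs ν k :=
  propagator Φ Λ (-t) * a * propagator Φ Λ t

/-- `F`-functions on `ℤ^ν`: positive non-increasing functions on `[0, ∞)` that are uniformly
summable and satisfy the convolution condition with some constant `C_F`. -/
structure IsFFunction (ν : ℕ) (F : ℝ → ℝ) : Prop where
  pos : ∀ r, 0 ≤ r → 0 < F r
  antitone : AntitoneOn F (Set.Ici 0)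
  summable : (⨆ x : Site ν, ∑' y : Site ν, ENNReal.ofReal (F (dist x y))) < ∞
  convolution : ∃ C : ℝ, 0 < C ∧ ∀ x y : Site ν,
    (∑' z : Site ν, ENNReal.ofReal (F (dist x z) * F (dist z y)))
      ≤ ENNReal.ofReal (C * F (dist x y))

/-- The `F`-norm `sup_{x,y} ∑_{Z ∋ x,y} ‖Φ(Z)‖ / F(d(x,y)) ∈ [0, ∞]` of an interaction. -/
def fNorm (F : ℝ → ℝ) (Φ : Finset (Site ν) → Obs ν k) : ℝ≥0∞ :=
  ⨆ (x : Site ν) (y : Site ν),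
    ∑' Z : {Z : Finset (Site ν) // x ∈ Z ∧ y ∈ Z}, ‖Φ Z‖ₑ / ENNReal.ofReal (F (dist x y))

/-- Increasing and absorbing sequences of finite volumes. -/
def IsIAS (Λ : ℕ → Finset (Site ν)) : Prop :=
  Monotone Λ ∧ ∀ x, ∃ n, x ∈ Λ n

/-! ### States and ground states -/

/-- States of the quasi-local algebra, as elements of its dual with the weak-* topology. -/
def IsState (φ : WeakDual ℂ (Obs ν k)) : Prop :=
  (∀ a, 0 ≤ φ (star a * a)) ∧ φ 1 = 1

/-- The state `φ` is a ground state of the dynamics `α` on the algebra `B`: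
`-i φ(a^* δ(a)) ≥ 0` for all `a ∈ B` in the domain of the generator `δ = (d/dt) α_t |_{t = 0}`. -/
def IsGroundState (α : ℝ → Obs ν k → Obs ν k) (B : StarSubalgebra ℂ (Obs ν k))
    (φ : WeakDual ℂ (Obs ν k)) : Prop :=
  IsState φ ∧ ∀ a ∈ B, ∀ d, HasDerivAt (fun t => α t a) d 0 → 0 ≤ -I * φ (star a * d)

/-- The restriction of the state `φ` to `𝒜_Λ` is a ground state of the local dynamics `α^Λ`. -/
def IsLocalGroundState (Φ : Finset (Site ν) → Obs ν k) (Λ : Finset (Site ν))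
    (φ : WeakDual ℂ (Obs ν k)) : Prop :=
  IsGroundState (localDynamics Φ Λ) (localAlgebra ν k Λ) φ

/-- `α` is the infinite-volume dynamics of `Φ`: the strongly continuous one-parameter group of
`*`-automorphisms which on local observables is the norm limit of the local dynamics along the
net of finite volumes. -/
structure IsBulkDynamics (Φ : Finset (Site ν) → Obs ν k)
    (α : ℝ → (Obs ν k ≃⋆ₐ[ℂ] Obs ν k)) : Prop where
  zero : ∀ a, α 0 a = a
  add : ∀ s t a, α (s + t) a = α s (α t a)
  continuous : ∀ a, Continuous (fun t => α t a)
  limit : ∀ t X, ∀ a ∈ localAlgebra ν k X,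
    Tendsto (fun Λ => localDynamics Φ Λ t a) atTop (𝓝 (α t a))

/-- The ground state condition on local observables: for `a ∈ 𝒜_X` the series
`δ(a) = ∑_{Z ∩ X ≠ ∅} [i Φ(Z), a]` converges and `-i φ(a^* δ(a)) ≥ 0`. -/
def SatisfiesGroundStateCondition (Φ : Finset (Site ν) → Obs ν k)
    (φ : WeakDual ℂ (Obs ν k)) : Prop :=
  ∀ X, ∀ a ∈ localAlgebra ν k X, ∃ d,
    HasSum (fun Z : {Z : Finset (Site ν) // ∃ x ∈ Z, x ∈ X} =>
      (I • Φ Z) * a - a * (I • Φ Z)) d ∧ 0 ≤ -I * φ (star a * d)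

/-- The state `φ` is a ground state of the infinite-volume system: the infinite-volume dynamics
exists, `φ` is a ground state of it (on the full domain of its generator), and the ground state
condition holds on local observables. -/
def IsBulkGroundState (Φ : Finset (Site ν) → Obs ν k) (φ : WeakDual ℂ (Obs ν k)) : Prop :=
  (∃ α, IsBulkDynamics Φ α ∧ IsGroundState (fun t a => α t a) ⊤ φ) ∧
    SatisfiesGroundStateCondition Φ φ

/-! ### Disorder -/

section Disorder

variable {Ω : Type*} [MeasurableSpace Ω]

/-- Disordered interactions. -/
structure IsDisorderedInteraction (P : Measure Ω) (h : Ω → Finset (Site ν) → Obs ν k) :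
    Prop where
  interaction : ∀ Z, ∀ᵐ ω ∂P, IsSelfAdjoint (h ω Z) ∧ h ω Z ∈ localAlgebra ν k Z
  measurable : ∀ Z, ∀ φ : WeakDual ℂ (Obs ν k), Measurable (fun ω => φ (h ω Z))

/-- Ergodic interactions: disordered interactions that are covariant with respect to an ergodic
action of `ℤ^ν` on the probability space by measure-preserving maps. -/
def IsErgodicInteraction (P : Measure Ω) (h : Ω → Finset (Site ν) → Obs ν k) : Prop :=
  IsDisorderedInteraction P h ∧
    ∃ _ : AddAction (Site ν) Ω, MeasurableConstVAdd (Site ν) Ω ∧ ErgodicVAdd (Site ν) Ω P ∧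
      ∀ x Z, ∀ᵐ ω ∂P, translate x (h ω Z) = h (x +ᵥ ω) (translateVol x Z)

/-- Weak-* measurability of a random functional. -/
def IsWeakStarMeasurable (Γ : Ω → WeakDual ℂ (Obs ν k)) : Prop :=
  ∀ a, Measurable (fun ω => Γ ω a)

/-- Disordered ground states: weak-* measurable maps into the state space that satisfy the
ground state condition almost surely. -/
structure IsDisorderedGroundState (P : Measure Ω) (h : Ω → Finset (Site ν) → Obs ν k)
    (Γ : Ω → WeakDual ℂ (Obs ν k)) : Prop where
  state : ∀ ω, IsState (Γ ω)
  measurable : IsWeakStarMeasurable Γ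
  ground : ∀ᵐ ω ∂P, SatisfiesGroundStateCondition (h ω) (Γ ω)

end Disorder

end QuantumSpin

end

open Filter Topology MeasureTheory Complex
open scoped ENNReal ComplexOrder

noncomputable section

namespace QuantumSpin

/-! ### Inner dynamics of a `C^*`-algebra -/

section Heisenberg

variable {A : Type*} [CStarAlgebra A]

/-! In finite volume the generator is the bounded commutator with the Hamiltonian, so the ground
state inequality is a closed condition on the state and the observables in it. It survives a weak-*
limit of states as soon as those observables converge in norm. Their convergence rests on locality.
A Lieb-Robinson bound uniform in the volume (`IsDecaying.lieb_robinson`) and the summability of the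
weighted interaction (`IsDecaying.summable_weight`) make the finite-volume evolutions a Cauchy net,
whose limit is the group `IsDecaying.bulkAut`; on local observables the commutators converge to
`bulkDeriv`.

Hence the inequality for local observables passes to the limit directly. On the full domain of the
generator no core has to be identified. The average `∫₀^ε α_s(b) ds` has derivative `α_ε(b) - b`; in
finite volume it stays in the local algebra, and both expressions converge with the volume without
mention of a generator. The limiting inequality extends to all `b` by density, and division by `ε²`
followed by `ε → 0` gives the condition for every `b` in the domain
(`IsDecaying.nonneg_of_hasDerivAt_bulk`).

For random interactions, the `F`-norm is invariant under translations, so ergodicity upgrades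
positive probability of finiteness to probability one (`ae_fNorm_lt_top`). The state space is weak-*
compact and the algebra is separable, so convergent subsequences can be selected measurably by a
diagonal procedure that decides countably many events (`exists_measurable_convergent_subsequence`).
Finite-volume ground states to start from are measurably chosen energy minimisers
(`exists_measurable_minimal_state`), which are ground states by a variational argument
(`IsPositiveState.nonneg_of_minimal`). -/

theorem norm_lie_le (a b : A) : ‖⁅a, b⁆‖ ≤ 2 * ‖a‖ * ‖b‖ := by
  rw [Ring.lie_def]
  calc ‖a * b - b * a‖ ≤ ‖a * b‖ + ‖b * a‖ := norm_sub_le _ _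
    _ ≤ ‖a‖ * ‖b‖ + ‖b‖ * ‖a‖ := add_le_add (norm_mul_le _ _) (norm_mul_le _ _)
    _ = 2 * ‖a‖ * ‖b‖ := by ring

/-- The Heisenberg evolution `a ↦ exp(i t H) a exp(-i t H)`. -/
def heisenberg (H : A) (t : ℝ) (a : A) : A :=
  NormedSpace.exp ((I * (t : ℂ)) • H) * a * NormedSpace.exp ((-(I * (t : ℂ))) • H)

theorem star_exp_I_smul {H : A} (hH : IsSelfAdjoint H) (t : ℝ) :
    star (NormedSpace.exp ((I * (t : ℂ)) • H)) = NormedSpace.exp ((-(I * (t : ℂ))) • H) := by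
  rw [NormedSpace.star_exp, star_smul, hH.star_eq]
  congr 2
  simp

theorem exp_mul_exp_neg (z : ℂ) (H : A) :
    NormedSpace.exp (z • H) * NormedSpace.exp ((-z) • H) = 1 := by
  let _ : NormedAlgebra ℚ A := NormedAlgebra.restrictScalars ℚ ℂ A
  rw [← NormedSpace.exp_add_of_commute, ← add_smul, add_neg_cancel, zero_smul,
    NormedSpace.exp_zero]
  exact ((Commute.refl H).smul_left z).smul_right (-z)

/-- The unitary `exp(i t H)` of a self-adjoint element `H`. -/
def expUnitary {H : A} (hH : IsSelfAdjoint H) (t : ℝ) : unitary A :=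
  ⟨NormedSpace.exp ((I * (t : ℂ)) • H), by
    rw [Unitary.mem_iff, star_exp_I_smul hH]
    refine ⟨?_, exp_mul_exp_neg _ _⟩
    simpa using exp_mul_exp_neg (-(I * (t : ℂ))) H⟩

/-- The Heisenberg evolution of a self-adjoint Hamiltonian as an automorphism. -/
def heisenbergAut {H : A} (hH : IsSelfAdjoint H) (t : ℝ) : A ≃⋆ₐ[ℂ] A :=
  Unitary.conjStarAlgAut ℂ A (expUnitary hH t)

theorem heisenbergAut_apply {H : A} (hH : IsSelfAdjoint H) (t : ℝ) (a : A) :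
    heisenbergAut hH t a = heisenberg H t a := by
  rw [heisenbergAut, Unitary.conjStarAlgAut_apply, heisenberg, ← star_exp_I_smul hH]
  rfl

theorem norm_heisenberg {H : A} (hH : IsSelfAdjoint H) (t : ℝ) (a : A) :
    ‖heisenberg H t a‖ = ‖a‖ := by
  rw [← heisenbergAut_apply hH, heisenbergAut, Unitary.conjStarAlgAut_apply,
    ← Unitary.coe_star, CStarRing.norm_mul_coe_unitary, CStarRing.norm_coe_unitary_mul]

@[simp] theorem heisenberg_zero (H a : A) : heisenberg H 0 a = a := by
  simp [heisenberg, NormedSpace.exp_zero]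

theorem heisenberg_add (H : A) (s t : ℝ) (a : A) :
    heisenberg H (s + t) a = heisenberg H s (heisenberg H t a) := by
  have key : ∀ z w : ℂ, NormedSpace.exp ((z + w) • H) =
      NormedSpace.exp (z • H) * NormedSpace.exp (w • H) := fun z w => by
    let _ : NormedAlgebra ℚ A := NormedAlgebra.restrictScalars ℚ ℂ A
    rw [add_smul, NormedSpace.exp_add_of_commute]
    exact ((Commute.refl H).smul_left z).smul_right w
  have h1 : I * ((s + t : ℝ) : ℂ) = I * s + I * t := by push_cast; ring
  have h2 : -(I * ((s + t : ℝ) : ℂ)) = -(I * t) + -(I * s) := by push_cast; ring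
  simp only [heisenberg]
  rw [h2, key, h1, key]
  simp only [mul_assoc]

theorem heisenberg_neg_apply (H : A) (t : ℝ) (a : A) :
    heisenberg H (-t) a = heisenberg (-H) t a := by
  simp [heisenberg]

theorem heisenberg_sub (H : A) (t : ℝ) (a b : A) :
    heisenberg H t (a - b) = heisenberg H t a - heisenberg H t b := by
  simp [heisenberg, mul_sub, sub_mul]

theorem hasDerivAt_exp_I_smul (H : A) (t : ℝ) :
    HasDerivAt (fun u : ℝ => NormedSpace.exp ((I * (u : ℂ)) • H))
      (NormedSpace.exp ((I * (t : ℂ)) • H) * (I • H)) t := by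
  have key : ∀ u : ℝ, (I * (u : ℂ)) • H = u • (I • H) := fun u => by
    rw [mul_comm, mul_smul, Complex.coe_smul]
  simp only [key]
  exact hasDerivAt_exp_smul_const (𝕂 := ℝ) (I • H) t

theorem commute_exp_smul (z : ℂ) (H : A) : Commute H (NormedSpace.exp (z • H)) :=
  ((Commute.refl H).smul_right z).exp_right

theorem hasDerivAt_heisenberg_comp (H : A) {b : ℝ → A} {b' : A} {t : ℝ}
    (hb : HasDerivAt b b' t) :
    HasDerivAt (fun u => heisenberg H u (b u)) (heisenberg H t (I • ⁅H, b t⁆ + b')) t := by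
  have h1 := hasDerivAt_exp_I_smul H t
  have h2 : HasDerivAt (fun u : ℝ => NormedSpace.exp ((-(I * (u : ℂ))) • H))
      (NormedSpace.exp ((-(I * (t : ℂ))) • H) * (-(I • H))) t := by
    have := hasDerivAt_exp_I_smul (-H) t
    simpa [smul_neg, neg_smul] using this
  refine ((h1.mul hb).mul h2).congr_deriv ?_
  have hc := (commute_exp_smul (-(I * (t : ℂ))) H).eq
  simp only [heisenberg, Pi.mul_apply, Ring.lie_def, smul_sub, mul_add, add_mul, mul_sub, sub_mul,
    mul_neg, mul_smul_comm, smul_mul_assoc, mul_assoc]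
  rw [hc]
  abel

theorem hasDerivAt_heisenberg (H a : A) (t : ℝ) :
    HasDerivAt (fun u => heisenberg H u a) (heisenberg H t (I • ⁅H, a⁆)) t := by
  simpa using hasDerivAt_heisenberg_comp H (hasDerivAt_const t a)

theorem heisenberg_lie_self (H a : A) (t : ℝ) :
    heisenberg H t (I • ⁅H, a⁆) = I • ⁅H, heisenberg H t a⁆ := by
  have h1 := (commute_exp_smul (-(I * (t : ℂ))) H).eq
  have h2 := (commute_exp_smul (I * (t : ℂ)) H).eq
  simp only [heisenberg, Ring.lie_def, smul_sub, mul_sub, sub_mul, mul_smul_comm,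
    smul_mul_assoc, mul_assoc]
  rw [← mul_assoc H (NormedSpace.exp _), h2, h1]
  simp only [mul_assoc]

theorem norm_lie_heisenberg_le {H : A} (hH : IsSelfAdjoint H) (t : ℝ) (a b : A) :
    ‖⁅a, heisenberg H t b⁆‖ ≤ 2 * ‖a‖ * ‖b‖ := by
  simpa [norm_heisenberg hH] using norm_lie_le a (heisenberg H t b)

theorem norm_heisenberg_sub_self_le {H : A} (hH : IsSelfAdjoint H) (t : ℝ) (a : A) :
    ‖heisenberg H t a - a‖ ≤ ‖⁅H, a⁆‖ * |t| := by
  have := Convex.norm_image_sub_le_of_norm_hasDerivWithin_le (f := fun u => heisenberg H u a)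
    (C := ‖⁅H, a⁆‖) (s := Set.univ) (x := 0) (y := t)
    (fun u _ => (hasDerivAt_heisenberg H a u).hasDerivWithinAt)
    (fun u _ => by rw [norm_heisenberg hH, norm_smul]; simp) convex_univ trivial trivial
  simpa using this

/-- Comparison of the dynamics of two Hamiltonians. -/
theorem norm_heisenberg_sub_heisenberg_le {H K : A} (hK : IsSelfAdjoint K) (b : A) {t C : ℝ} (ht : 0 ≤ t)
    (hC : ∀ s ∈ Set.Icc 0 t, ‖⁅K - H, heisenberg H s b⁆‖ ≤ C) :
    ‖heisenberg K t b - heisenberg H t b‖ ≤ C * t := by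
  -- Duhamel: evolving forward with `H` and back with `K` leaves only the commutator with `K - H`,
  -- and the backward evolution is isometric.
  have hd : ∀ s, HasDerivAt (fun s => heisenberg (-K) s (heisenberg H s b))
      (heisenberg (-K) s (-(I • ⁅K - H, heisenberg H s b⁆))) s := fun s => by
    have := hasDerivAt_heisenberg_comp (-K) (hasDerivAt_heisenberg H b s)
    rw [heisenberg_lie_self] at this
    refine this.congr_deriv (congrArg _ ?_)
    simp only [Ring.lie_def, ← smul_neg, ← smul_add]
    congr 1
    noncomm_ring
  have := Convex.norm_image_sub_le_of_norm_hasDerivWithin_le (C := C) (s := Set.Icc 0 t)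
    (x := 0) (y := t) (fun s _ => (hd s).hasDerivWithinAt)
    (fun s hs => by rw [norm_heisenberg hK.neg, norm_neg, norm_smul]; simpa using hC s hs)
    (convex_Icc 0 t) ⟨le_rfl, ht⟩ ⟨ht, le_rfl⟩
  have h2 : heisenberg (-K) t (heisenberg H t b) - b
      = heisenberg (-K) t (heisenberg H t b - heisenberg K t b) := by
    rw [heisenberg_sub, ← heisenberg_neg_apply, ← heisenberg_neg_apply, ← heisenberg_add]
    simp
  simp only [heisenberg_zero] at this
  rw [h2, norm_heisenberg hK.neg, norm_sub_rev] at this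
  simpa [abs_of_nonneg ht] using this

/-- If `D` commutes with `a`, then the evolution of `b` under `D + K` approaches `a` at a speed
controlled by `K`. -/
theorem norm_lie_heisenberg_le_of_commute {D K : A} (hD : IsSelfAdjoint D)
    (a b : A) (hDa : Commute D a) {G G' : ℝ → ℝ}
    (hG : ∀ s, HasDerivAt G (G' s) s) (h0 : ‖⁅a, b⁆‖ ≤ G 0) {t : ℝ} (ht : 0 ≤ t)
    (hG' : ∀ s, 0 ≤ s → 2 * ‖a‖ * ‖⁅K, heisenberg (D + K) s b⁆‖ ≤ G' s) :
    ‖⁅a, heisenberg (D + K) t b⁆‖ ≤ G t := by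
  have hb : ∀ s, HasDerivAt (fun s => ⁅a, heisenberg (D + K) s b⁆)
      ⁅a, I • ⁅D + K, heisenberg (D + K) s b⁆⁆ s := fun s => by
    have := hasDerivAt_heisenberg (D + K) b s
    rw [heisenberg_lie_self] at this
    simp only [Ring.lie_def a]
    exact (this.const_mul a).sub (this.mul_const a)
  -- Interaction picture: since `D` commutes with `a`, the Jacobi identity gives `⁅a, ⁅D, x⁆⁆ = ⁅D,
  -- ⁅a, x⁆⁆`, and undoing the isometric evolution under `D` cancels this term.
  have hd : ∀ s, HasDerivAt (fun s => heisenberg (-D) s ⁅a, heisenberg (D + K) s b⁆)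
      (heisenberg (-D) s (I • ⁅a, ⁅K, heisenberg (D + K) s b⁆⁆)) s := fun s => by
    have := hasDerivAt_heisenberg_comp (-D) (hb s)
    refine this.congr_deriv (congrArg _ ?_)
    simp only [Ring.lie_def, mul_smul_comm, smul_mul_assoc, ← smul_sub, ← smul_add]
    congr 1
    simp only [mul_sub, sub_mul, mul_add, add_mul, neg_mul, mul_neg, ← mul_assoc, hDa.eq]
    simp only [mul_assoc, hDa.eq]
    abel
  have hn : ∀ s, ‖heisenberg (-D) s ⁅a, heisenberg (D + K) s b⁆‖
      = ‖⁅a, heisenberg (D + K) s b⁆‖ := fun s => norm_heisenberg hD.neg _ _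
  have := image_norm_le_of_norm_deriv_right_le_deriv_boundary
    (a := 0) (b := t) (f := fun s => heisenberg (-D) s ⁅a, heisenberg (D + K) s b⁆)
    (fun s _ => (hd s).continuousAt.continuousWithinAt)
    (fun s _ => (hd s).hasDerivWithinAt) (B := G) (B' := G') (by simpa using h0) hG
    (fun s hs => by
      rw [norm_heisenberg hD.neg, norm_smul, norm_I, one_mul]
      exact (norm_lie_le _ _).trans (hG' s hs.1)) ⟨ht, le_rfl⟩
  rwa [hn] at this

end Heisenberg

/-! ### Decaying interactions and Lieb-Robinson bounds -/

section LiebRobinson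

variable {A : Type*} [CStarAlgebra A] {S : Type*} [DecidableEq S]

/-- A net of local algebras: isotony, locality, density and closedness. -/
structure IsLocalNet (L : Finset S → StarSubalgebra ℂ A) : Prop where
  mono : ∀ {X Y}, X ⊆ Y → L X ≤ L Y
  commute : ∀ {X Y}, Disjoint X Y → ∀ a ∈ L X, ∀ b ∈ L Y, Commute a b
  dense : Dense (⋃ X, (L X : Set A))
  closed : ∀ X, IsClosed (L X : Set A)

/-- An interaction `Φ` for the net `L` whose two-point sums are dominated by the kernel `N f`,
where `f` is uniformly summable and satisfies a convolution condition. -/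
structure IsDecaying (L : Finset S → StarSubalgebra ℂ A) (f : S → S → ℝ) (f₀ C M N : ℝ)
    (Φ : Finset S → A) : Prop where
  selfAdjoint : ∀ Z, IsSelfAdjoint (Φ Z)
  mem : ∀ Z, Φ Z ∈ L Z
  pos : ∀ x y, 0 < f x y
  diag : ∀ x, f x x = f₀
  diag_pos : 0 < f₀
  conv_nonneg : 0 ≤ C
  bound_nonneg : 0 ≤ N
  conv : ∀ (W : Finset S) x y, ∑ z ∈ W, f x z * f z y ≤ C * f x y
  sum_le : ∀ (W : Finset S) y, ∑ z ∈ W, f z y ≤ M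
  bound : ∀ (Λ : Finset S) x z, ∑ Z ∈ Λ.powerset with x ∈ Z ∧ z ∈ Z, ‖Φ Z‖ ≤ N * f x z

/-- The total weight `∑_{x ∈ X, y ∈ Y} f(x, y)`. -/
def weight (f : S → S → ℝ) (Y X : Finset S) : ℝ := ∑ x ∈ X, ∑ y ∈ Y, f x y

/-- The Hamiltonian of an interaction in a finite volume. -/
def energy (Φ : Finset S → A) (Λ : Finset S) : A := ∑ Z ∈ Λ.powerset, Φ Z

variable {L : Finset S → StarSubalgebra ℂ A} {f : S → S → ℝ} {f₀ C M N : ℝ} {Φ : Finset S → A}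

namespace IsDecaying

theorem neg (h : IsDecaying L f f₀ C M N Φ) : IsDecaying L f f₀ C M N (-Φ) :=
  { h with
    selfAdjoint := fun Z => (h.selfAdjoint Z).neg
    mem := fun Z => neg_mem (h.mem Z)
    bound := fun Λ x z => by simpa using h.bound Λ x z }

theorem energy_selfAdjoint (h : IsDecaying L f f₀ C M N Φ) (Λ : Finset S) :
    IsSelfAdjoint (energy Φ Λ) :=
  isSelfAdjoint_sum _ fun Z _ => h.selfAdjoint Z

theorem energy_mem (h : IsDecaying L f f₀ C M N Φ) (hL : IsLocalNet L) (Λ : Finset S) :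
    energy Φ Λ ∈ L Λ :=
  sum_mem fun Z hZ => hL.mono (Finset.mem_powerset.mp hZ) (h.mem Z)

theorem weight_nonneg (h : IsDecaying L f f₀ C M N Φ) (Y X : Finset S) : 0 ≤ weight f Y X :=
  Finset.sum_nonneg fun x _ => Finset.sum_nonneg fun y _ => (h.pos x y).le

theorem le_weight (h : IsDecaying L f f₀ C M N Φ) {Y X : Finset S} {x y : S} (hx : x ∈ X)
    (hy : y ∈ Y) : f x y ≤ weight f Y X :=
  (Finset.single_le_sum (fun z _ => (h.pos x z).le) hy).trans
    (Finset.single_le_sum (f := fun x => ∑ y ∈ Y, f x y)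
      (fun z _ => Finset.sum_nonneg fun y _ => (h.pos z y).le) hx)

/-- Each `Z` is charged to a point `x ∈ Z ∩ X`, and its weight is expanded over `z ∈ Z`. Summing
first over the sets through `x` and `z` costs `N f(x, z)`; the convolution condition then absorbs
the sum over `z`. -/
theorem sum_inter_le (h : IsDecaying L f f₀ C M N Φ) (Λ Y X : Finset S) :
    ∑ Z ∈ Λ.powerset with ¬ Disjoint Z X, ‖Φ Z‖ * weight f Y Z ≤ N * C * weight f Y X := by
  have h1 : ∀ Z ∈ Λ.powerset, (if ¬ Disjoint Z X then ‖Φ Z‖ * weight f Y Z else 0) ≤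
      ∑ x ∈ X, ∑ z ∈ Λ, (if x ∈ Z ∧ z ∈ Z then ‖Φ Z‖ else 0) * ∑ y ∈ Y, f z y := by
    intro Z hZ
    have hnn : ∀ x z, 0 ≤ (if x ∈ Z ∧ z ∈ Z then ‖Φ Z‖ else 0) * ∑ y ∈ Y, f z y := fun x z =>
      mul_nonneg (by split_ifs <;> simp) (Finset.sum_nonneg fun y _ => (h.pos z y).le)
    split_ifs with hd
    · exact Finset.sum_nonneg fun x _ => Finset.sum_nonneg fun z _ => hnn x z
    · obtain ⟨x, hxZ, hxX⟩ := Finset.not_disjoint_iff.mp hd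
      refine le_trans ?_ (Finset.single_le_sum
        (fun x _ => Finset.sum_nonneg fun z _ => hnn x z) hxX)
      rw [weight, Finset.mul_sum]
      refine le_trans (le_of_eq ?_) (Finset.sum_le_sum_of_subset_of_nonneg
        (Finset.mem_powerset.mp hZ) fun z _ _ => hnn x z)
      exact Finset.sum_congr rfl fun z hz => by simp [hxZ, hz]
  rw [Finset.sum_filter]
  refine (Finset.sum_le_sum h1).trans ?_
  rw [Finset.sum_comm, weight, Finset.mul_sum]
  refine Finset.sum_le_sum fun x _ => ?_
  rw [Finset.sum_comm]
  calc ∑ z ∈ Λ, ∑ Z ∈ Λ.powerset, (if x ∈ Z ∧ z ∈ Z then ‖Φ Z‖ else 0) * ∑ y ∈ Y, f z y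
      ≤ ∑ z ∈ Λ, N * f x z * ∑ y ∈ Y, f z y := by
        refine Finset.sum_le_sum fun z _ => ?_
        rw [← Finset.sum_mul, ← Finset.sum_filter]
        exact mul_le_mul_of_nonneg_right (h.bound Λ x z)
          (Finset.sum_nonneg fun y _ => (h.pos z y).le)
    _ = N * ∑ y ∈ Y, ∑ z ∈ Λ, f x z * f z y := by
        rw [Finset.sum_comm, Finset.mul_sum]
        refine Finset.sum_congr rfl fun z _ => ?_
        simp only [Finset.mul_sum, mul_assoc]
    _ ≤ N * ∑ y ∈ Y, C * f x y :=
        mul_le_mul_of_nonneg_left (Finset.sum_le_sum fun y _ => h.conv Λ x y) h.bound_nonneg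
    _ = N * C * ∑ y ∈ Y, f x y := by rw [← Finset.mul_sum, mul_assoc]

/-- The two-point bound on the diagonal gives at most `N f₀` for the sets through a given `z`, and
`f(z, y)` is summable in `z`. The tails of this series control the dependence of the dynamics on the
volume. -/
theorem summable_weight (h : IsDecaying L f f₀ C M N Φ) (Y : Finset S) :
    Summable fun Z => ‖Φ Z‖ * weight f Y Z := by
  have hnn : ∀ Z, 0 ≤ ‖Φ Z‖ * weight f Y Z := fun Z =>
    mul_nonneg (norm_nonneg _) (h.weight_nonneg Y Z)
  refine summable_of_sum_le (c := N * f₀ * ∑ _y ∈ Y, M) hnn fun T => ?_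
  set Λ : Finset S := T.biUnion id
  have hT : T ⊆ Λ.powerset := fun Z hZ =>
    Finset.mem_powerset.mpr (Finset.subset_biUnion_of_mem id hZ)
  refine (Finset.sum_le_sum_of_subset_of_nonneg hT fun Z _ _ => hnn Z).trans ?_
  calc ∑ Z ∈ Λ.powerset, ‖Φ Z‖ * weight f Y Z
      = ∑ Z ∈ Λ.powerset, ∑ z ∈ Λ, (if z ∈ Z ∧ z ∈ Z then ‖Φ Z‖ else 0) * ∑ y ∈ Y, f z y := by
        refine Finset.sum_congr rfl fun Z hZ => ?_
        rw [weight, Finset.mul_sum]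
        refine Finset.sum_subset_zero_on_sdiff (Finset.mem_powerset.mp hZ)
          (fun z hz => ?_) (fun z hz => ?_)
        · simp [(Finset.mem_sdiff.mp hz).2]
        · simp [hz]
    _ ≤ ∑ z ∈ Λ, N * f₀ * ∑ y ∈ Y, f z y := by
        rw [Finset.sum_comm]
        refine Finset.sum_le_sum fun z _ => ?_
        rw [← Finset.sum_mul, ← Finset.sum_filter, ← h.diag z]
        exact mul_le_mul_of_nonneg_right (h.bound Λ z z)
          (Finset.sum_nonneg fun y _ => (h.pos z y).le)
    _ = N * f₀ * ∑ y ∈ Y, ∑ z ∈ Λ, f z y := by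
        rw [← Finset.mul_sum, Finset.sum_comm]
    _ ≤ N * f₀ * ∑ _y ∈ Y, M :=
        mul_le_mul_of_nonneg_left (Finset.sum_le_sum fun y _ => h.sum_le Λ y)
          (mul_nonneg h.bound_nonneg h.diag_pos.le)

/-- The bound at time zero: disjoint supports commute, and a common point `x` contributes `f x x =
f₀` to the weight. -/
theorem norm_lie_le_weight (h : IsDecaying L f f₀ C M N Φ) (hL : IsLocalNet L)
    {X Y : Finset S} {a b : A} (ha : a ∈ L X) (hb : b ∈ L Y) :
    ‖⁅a, b⁆‖ ≤ 2 * ‖b‖ / f₀ * weight f Y X * ‖a‖ := by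
  by_cases hd : Disjoint X Y
  · rw [Ring.lie_def, (hL.commute hd a ha b hb).eq, sub_self, norm_zero]
    have := h.weight_nonneg Y X
    have := h.diag_pos
    positivity
  · obtain ⟨x, hxX, hxY⟩ := Finset.not_disjoint_iff.mp hd
    have h1 : f₀ ≤ weight f Y X := h.diag x ▸ h.le_weight hxX hxY
    calc ‖⁅a, b⁆‖ ≤ 2 * ‖a‖ * ‖b‖ := norm_lie_le a b
      _ = 2 * ‖b‖ / f₀ * f₀ * ‖a‖ := by
        have := h.diag_pos.ne'
        field_simp
      _ ≤ 2 * ‖b‖ / f₀ * weight f Y X * ‖a‖ := by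
        have := h.diag_pos
        gcongr

/-- One step of the Lieb-Robinson iteration. -/
theorem lieb_robinson_step (h : IsDecaying L f f₀ C M N Φ) (hL : IsLocalNet L)
    {Λ W Y : Finset S} (hW : Λ ⊆ W) {b : A} (hb : b ∈ L Y) {K : ℝ} (hK : 0 ≤ K)
    (hb' : ∀ X ⊆ W, X.Nonempty → ∀ a ∈ L X, ∀ t, 0 ≤ t →
      ‖⁅a, heisenberg (energy Φ Λ) t b⁆‖
        ≤ K * Real.exp (4 * N * C * t) * weight f Y X * ‖a‖)
    {X : Finset S} {a : A} (ha : a ∈ L X) {t : ℝ} (ht : 0 ≤ t) :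
    ‖⁅a, heisenberg (energy Φ Λ) t b⁆‖
      ≤ (2 * ‖b‖ / f₀ + K / 2) * Real.exp (4 * N * C * t) * weight f Y X * ‖a‖ := by
  have hw := h.weight_nonneg Y X
  -- The estimate below bounds the derivative by `2 N C K exp(κ s)` times `weight f Y X * ‖a‖`. With
  -- twice that rate as `κ`, its integral carries the factor `K / 2`, which makes the iteration a
  -- contraction.
  set κ := 4 * N * C with hκ
  have hκ0 : 0 ≤ κ := by
    have := h.bound_nonneg
    have := h.conv_nonneg
    positivity
  -- Terms supported away from `X` commute with `a`; only those meeting `X` drive the growth of the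
  -- commutator.
  set D : A := ∑ Z ∈ Λ.powerset with Disjoint Z X, Φ Z
  set E : A := ∑ Z ∈ Λ.powerset with ¬ Disjoint Z X, Φ Z with hE
  have hDE : energy Φ Λ = D + E := (Finset.sum_filter_add_sum_filter_not _ _ _).symm
  have hD : IsSelfAdjoint D := isSelfAdjoint_sum _ fun Z _ => h.selfAdjoint Z
  have hDa : Commute D a := Commute.sum_left _ _ _ fun Z hZ =>
    hL.commute (Finset.mem_filter.mp hZ).2 _ (h.mem Z) _ ha
  have hG : ∀ s : ℝ, HasDerivAt
      (fun s => (2 * ‖b‖ / f₀ + K / 2 * Real.exp (κ * s)) * weight f Y X * ‖a‖)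
      (K / 2 * (Real.exp (κ * s) * κ) * weight f Y X * ‖a‖) s := fun s => by
    have h1 : HasDerivAt (fun s => Real.exp (κ * s)) (Real.exp (κ * s) * κ) s := by
      simpa using ((hasDerivAt_id s).const_mul κ).exp
    exact (((h1.const_mul (K / 2)).const_add _).mul_const _).mul_const _
  rw [hDE] at hb' ⊢
  refine (norm_lie_heisenberg_le_of_commute (K := E) hD a b hDa hG ?_ ht fun s hs => ?_).trans ?_
  · refine (h.norm_lie_le_weight hL ha hb).trans ?_
    gcongr
    have : 0 ≤ K / 2 * Real.exp (κ * 0) := by positivity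
    linarith
  · have h1 : ‖⁅E, heisenberg (D + E) s b⁆‖
        ≤ K * Real.exp (κ * s) * (N * C * weight f Y X) := by
      have h2 : ⁅E, heisenberg (D + E) s b⁆
          = ∑ Z ∈ Λ.powerset with ¬ Disjoint Z X, ⁅Φ Z, heisenberg (D + E) s b⁆ := by
        simp only [Ring.lie_def, hE, Finset.sum_mul, Finset.mul_sum, Finset.sum_sub_distrib]
      rw [h2]
      refine (norm_sum_le _ _).trans (le_trans ?_
        (mul_le_mul_of_nonneg_left (h.sum_inter_le Λ Y X) (by positivity)))
      rw [Finset.mul_sum]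
      refine Finset.sum_le_sum fun Z hZ => ?_
      obtain ⟨hZΛ, hZX⟩ := Finset.mem_filter.mp hZ
      obtain ⟨z, hz, -⟩ := Finset.not_disjoint_iff.mp hZX
      refine (hb' Z ((Finset.mem_powerset.mp hZΛ).trans hW) ⟨z, hz⟩ _ (h.mem Z) s hs).trans
        (le_of_eq ?_)
      ring
    calc 2 * ‖a‖ * ‖⁅E, heisenberg (D + E) s b⁆‖
        ≤ 2 * ‖a‖ * (K * Real.exp (κ * s) * (N * C * weight f Y X)) := by gcongr
      _ = K / 2 * (Real.exp (κ * s) * κ) * weight f Y X * ‖a‖ := by rw [hκ]; ring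
  · have h1 : 1 ≤ Real.exp (κ * t) := Real.one_le_exp (by positivity)
    have h2 : 0 ≤ 2 * ‖b‖ / f₀ := div_nonneg (by positivity) h.diag_pos.le
    gcongr
    nlinarith

/-- A Lieb-Robinson bound, uniform in the volume. -/
theorem lieb_robinson (h : IsDecaying L f f₀ C M N Φ) (hL : IsLocalNet L)
    (Λ : Finset S) {X Y : Finset S} (hY : Y.Nonempty) {a b : A} (ha : a ∈ L X)
    (hb : b ∈ L Y) {t : ℝ} (ht : 0 ≤ t) :
    ‖⁅a, heisenberg (energy Φ Λ) t b⁆‖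
      ≤ 4 * ‖b‖ / f₀ * Real.exp (4 * N * C * t) * weight f Y X * ‖a‖ := by
  set W := Λ ∪ X with hWdef
  have hNC : 0 ≤ 4 * N * C := by
    have := h.bound_nonneg
    have := h.conv_nonneg
    positivity
  have hb0 : 0 ≤ 2 * ‖b‖ / f₀ := div_nonneg (by positivity) h.diag_pos.le
  obtain ⟨y, hy⟩ := hY
  -- A crude constant: on nonempty subsets of the finite set `W` the weight is bounded below, so the
  -- trivial commutator bound has the required form. It depends on the volume but disappears in the
  -- limit.
  set K₀ : ℝ := ∑ w ∈ W, 2 * ‖b‖ / f w y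
  have hK0 : 0 ≤ K₀ := Finset.sum_nonneg fun w _ => div_nonneg (by positivity) (h.pos w y).le
  -- The step maps `K` to `2‖b‖/f₀ + K/2`, whose fixed point is `4‖b‖/f₀`; each iteration halves the
  -- excess.
  have key : ∀ n : ℕ, ∀ X ⊆ W, X.Nonempty → ∀ a ∈ L X, ∀ t, 0 ≤ t →
      ‖⁅a, heisenberg (energy Φ Λ) t b⁆‖
        ≤ (4 * ‖b‖ / f₀ + K₀ / 2 ^ n) * Real.exp (4 * N * C * t) * weight f Y X * ‖a‖ := by
    intro n
    induction n with
    | zero =>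
      rintro X hX ⟨x, hx⟩ a ha t ht
      have hw := h.weight_nonneg Y X
      have h1 : 2 * ‖b‖ ≤ K₀ * weight f Y X := by
        calc 2 * ‖b‖ = 2 * ‖b‖ / f x y * f x y := by
              have := (h.pos x y).ne'
              field_simp
          _ ≤ K₀ * weight f Y X := by
              refine mul_le_mul ?_ (h.le_weight hx hy) (h.pos x y).le hK0
              exact Finset.single_le_sum (f := fun w => 2 * ‖b‖ / f w y)
                (fun w _ => div_nonneg (by positivity) (h.pos w y).le) (hX hx)
      have he : 1 ≤ Real.exp (4 * N * C * t) := Real.one_le_exp (mul_nonneg hNC ht)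
      have h4 : 0 ≤ 4 * ‖b‖ / f₀ := div_nonneg (by positivity) h.diag_pos.le
      calc ‖⁅a, heisenberg (energy Φ Λ) t b⁆‖ ≤ 2 * ‖a‖ * ‖b‖ :=
            norm_lie_heisenberg_le (h.energy_selfAdjoint Λ) t a b
        _ = 2 * ‖b‖ * ‖a‖ := by ring
        _ ≤ K₀ * 1 * weight f Y X * ‖a‖ := by
            rw [mul_one]
            gcongr
        _ ≤ _ := by
            gcongr
            simpa using h4
    | succ n ih =>
      intro X hX _ a ha t ht
      have h4 : 4 * ‖b‖ / f₀ = 2 * (2 * ‖b‖ / f₀) := by ring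
      have := h.lieb_robinson_step hL (Finset.subset_union_left) hb
        (K := 4 * ‖b‖ / f₀ + K₀ / 2 ^ n) (by rw [h4]; positivity) ih ha ht
      refine this.trans (le_of_eq ?_)
      congr 3
      rw [pow_succ]
      ring
  have h4 : Tendsto (fun n : ℕ => (4 * ‖b‖ / f₀ + K₀ / 2 ^ n) * Real.exp (4 * N * C * t) *
      weight f Y X * ‖a‖) atTop
      (𝓝 ((4 * ‖b‖ / f₀ + 0) * Real.exp (4 * N * C * t) * weight f Y X * ‖a‖)) := by
    refine (((tendsto_const_nhds.add ?_).mul_const _).mul_const _).mul_const _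
    exact tendsto_const_nhds.div_atTop (tendsto_pow_atTop_atTop_of_one_lt one_lt_two)
  rw [add_zero] at h4
  -- For empty `X` the weight vanishes and the crude bound is unavailable; a single step still
  -- applies, because it uses its hypothesis only for sets meeting `X`.
  rcases X.eq_empty_or_nonempty with rfl | hX
  · have := h.lieb_robinson_step hL (Finset.subset_union_left) hb
      (K := 4 * ‖b‖ / f₀ + K₀ / 2 ^ 0)
      (add_nonneg (div_nonneg (by positivity) h.diag_pos.le) (by positivity)) (key 0) ha ht
    simpa [weight] using this
  · exact ge_of_tendsto' h4 fun n => key n X Finset.subset_union_right hX a ha t ht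

end IsDecaying

end LiebRobinson

/-! ### The infinite-volume dynamics -/

section Bulk

variable {A : Type*} [CStarAlgebra A] {S : Type*} [DecidableEq S]

variable {L : Finset S → StarSubalgebra ℂ A} {f : S → S → ℝ} {f₀ C M N : ℝ} {Φ : Finset S → A}

/-- The infinite-volume dynamics of an interaction, as a limit of finite-volume dynamics. -/
def bulk (Φ : Finset S → A) (t : ℝ) (a : A) : A :=
  limUnder atTop fun Λ => heisenberg (energy Φ Λ) t a

/-- The generator `δ(a) = ∑_Z [i Φ(Z), a]` of the infinite-volume dynamics. -/
def bulkDeriv (Φ : Finset S → A) (a : A) : A := ∑' Z, I • ⁅Φ Z, a⁆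

omit [DecidableEq S] in
theorem energy_neg (Φ : Finset S → A) (Λ : Finset S) : energy (-Φ) Λ = -energy Φ Λ := by
  simp [energy]

theorem energy_sub_energy (Φ : Finset S → A) {Λ Λ' : Finset S} (hΛ : Λ ⊆ Λ') :
    energy Φ Λ' - energy Φ Λ = ∑ Z ∈ Λ'.powerset \ Λ.powerset, Φ Z :=
  sub_eq_of_eq_add (Finset.sum_sdiff (Finset.powerset_mono.mpr hΛ)).symm

omit [DecidableEq S] in
theorem IsLocalNet.exists_mem_norm_sub_lt (hL : IsLocalNet L) (a : A) {ε : ℝ} (hε : 0 < ε) :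
    ∃ X, ∃ b ∈ L X, ‖a - b‖ < ε := by
  obtain ⟨b, hb, hab⟩ := Metric.mem_closure_iff.mp (hL.dense a) ε hε
  obtain ⟨X, hX⟩ := Set.mem_iUnion.mp hb
  exact ⟨X, b, hX, by rwa [← dist_eq_norm]⟩

theorem IsLocalNet.exists_nonempty_mem [Nonempty S] (hL : IsLocalNet L) {X : Finset S} {b : A}
    (hb : b ∈ L X) : ∃ Y : Finset S, Y.Nonempty ∧ b ∈ L Y :=
  ⟨insert (Classical.arbitrary S) X, Finset.insert_nonempty _ _,
    hL.mono (Finset.subset_insert _ _) hb⟩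

omit [DecidableEq S] in
theorem IsLocalNet.heisenberg_mem (hL : IsLocalNet L) {Λ : Finset S} {H a : A} (hH : H ∈ L Λ)
    (ha : a ∈ L Λ) (t : ℝ) : heisenberg H t a ∈ L Λ := by
  let _ : Algebra ℚ A := Algebra.compHom A (algebraMap ℚ ℂ)
  have : IsScalarTower ℚ ℂ A := ⟨fun q z a => by
    rw [Rat.smul_def, mul_smul, ← algebraMap_smul ℂ q (z • a)]
    rfl⟩
  have key : ∀ z : ℂ, NormedSpace.exp (z • H) ∈ L Λ := fun z =>
    NormedSpace.exp_mem (R := ℂ) (hL.closed Λ) (SMulMemClass.smul_mem z hH)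
  exact mul_mem (mul_mem (key _) ha) (key _)

namespace IsDecaying

/-- Duhamel's comparison of the two volumes, with the Lieb-Robinson bound applied to every
interaction term not contained in `Λ`. The right side is an increment of the partial sums of a
convergent series. -/
theorem norm_heisenberg_sub_le_of_subset (h : IsDecaying L f f₀ C M N Φ) (hL : IsLocalNet L)
    {Y : Finset S} (hY : Y.Nonempty) {b : A} (hb : b ∈ L Y) {t : ℝ} (ht : 0 ≤ t)
    {Λ Λ' : Finset S} (hΛ : Λ ⊆ Λ') :
    ‖heisenberg (energy Φ Λ') t b - heisenberg (energy Φ Λ) t b‖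
      ≤ 4 * ‖b‖ / f₀ * Real.exp (4 * N * C * t) * t *
        (∑ Z ∈ Λ'.powerset, ‖Φ Z‖ * weight f Y Z - ∑ Z ∈ Λ.powerset, ‖Φ Z‖ * weight f Y Z) := by
  have hb0 : 0 ≤ 4 * ‖b‖ / f₀ := div_nonneg (by positivity) h.diag_pos.le
  have hNC : 0 ≤ 4 * N * C := by
    have := h.bound_nonneg
    have := h.conv_nonneg
    positivity
  rw [← Finset.sum_sdiff (Finset.powerset_mono.mpr hΛ), add_sub_cancel_right]
  refine (norm_heisenberg_sub_heisenberg_le (h.energy_selfAdjoint Λ') b ht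
    (C := 4 * ‖b‖ / f₀ * Real.exp (4 * N * C * t) *
      ∑ Z ∈ Λ'.powerset \ Λ.powerset, ‖Φ Z‖ * weight f Y Z) fun s hs => ?_).trans
      (le_of_eq (by ring))
  have h2 : ⁅energy Φ Λ' - energy Φ Λ, heisenberg (energy Φ Λ) s b⁆
      = ∑ Z ∈ Λ'.powerset \ Λ.powerset, ⁅Φ Z, heisenberg (energy Φ Λ) s b⁆ := by
    rw [energy_sub_energy Φ hΛ]
    simp only [Ring.lie_def, Finset.sum_mul, Finset.mul_sum, Finset.sum_sub_distrib]
  rw [h2, Finset.mul_sum]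
  refine (norm_sum_le _ _).trans (Finset.sum_le_sum fun Z _ => ?_)
  have hw := h.weight_nonneg Y Z
  calc ‖⁅Φ Z, heisenberg (energy Φ Λ) s b⁆‖
      ≤ 4 * ‖b‖ / f₀ * Real.exp (4 * N * C * s) * weight f Y Z * ‖Φ Z‖ :=
        h.lieb_robinson hL Λ hY (h.mem Z) hb hs.1
    _ ≤ 4 * ‖b‖ / f₀ * Real.exp (4 * N * C * t) * weight f Y Z * ‖Φ Z‖ := by
        have := hs.2
        gcongr
    _ = _ := by ring

theorem cauchySeq_heisenberg_of_nonneg [Nonempty S] (h : IsDecaying L f f₀ C M N Φ)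
    (hL : IsLocalNet L) {X : Finset S} {b : A} (hb : b ∈ L X) {t : ℝ} (ht : 0 ≤ t) :
    CauchySeq fun Λ => heisenberg (energy Φ Λ) t b := by
  obtain ⟨Y, hY, hb⟩ := hL.exists_nonempty_mem hb
  set c := 4 * ‖b‖ / f₀ * Real.exp (4 * N * C * t) * t
  have hc : 0 ≤ c := by
    have : 0 ≤ 4 * ‖b‖ / f₀ := div_nonneg (by positivity) h.diag_pos.le
    positivity
  have hQ : CauchySeq fun Λ : Finset S => c * ∑ Z ∈ Λ.powerset, ‖Φ Z‖ * weight f Y Z :=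
    (((h.summable_weight Y).hasSum.comp tendsto_finset_powerset_atTop_atTop).const_mul
      c).cauchySeq
  rw [Metric.cauchySeq_iff'] at hQ ⊢
  intro ε hε
  obtain ⟨Λ, hΛ⟩ := hQ ε hε
  refine ⟨Λ, fun Λ' hΛ' => lt_of_le_of_lt ?_ (hΛ Λ' hΛ')⟩
  rw [dist_eq_norm, Real.dist_eq, ← mul_sub]
  exact (h.norm_heisenberg_sub_le_of_subset hL hY hb ht hΛ').trans (le_abs_self _)

/-- Local observables are dense and all finite-volume evolutions are isometric, so the Cauchy
property passes to the whole algebra. -/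
theorem cauchySeq_heisenberg [Nonempty S] (h : IsDecaying L f f₀ C M N Φ)
    (hL : IsLocalNet L) (t : ℝ) (a : A) :
    CauchySeq fun Λ => heisenberg (energy Φ Λ) t a := by
  rw [Metric.cauchySeq_iff']
  intro ε hε
  obtain ⟨X, b, hb, hab⟩ := hL.exists_mem_norm_sub_lt a (by positivity : 0 < ε / 3)
  have hcb : CauchySeq fun Λ => heisenberg (energy Φ Λ) t b := by
    rcases le_total 0 t with ht | ht
    · exact h.cauchySeq_heisenberg_of_nonneg hL hb ht
    -- Negative times are positive times for the interaction `-Φ`.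
    · have := h.neg.cauchySeq_heisenberg_of_nonneg hL hb (neg_nonneg.mpr ht)
      simpa only [energy_neg, ← heisenberg_neg_apply, neg_neg] using this
  obtain ⟨Λ, hΛ⟩ := Metric.cauchySeq_iff'.mp hcb (ε / 3) (by positivity)
  refine ⟨Λ, fun Λ' hΛ' => ?_⟩
  have key : ∀ Λ, dist (heisenberg (energy Φ Λ) t a) (heisenberg (energy Φ Λ) t b) < ε / 3 :=
    fun Λ => by
      rwa [dist_eq_norm, ← heisenberg_sub, norm_heisenberg (h.energy_selfAdjoint Λ)]
  have h1 := key Λ'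
  have h2 := key Λ
  rw [dist_comm] at h2
  have h3 := dist_triangle4 (heisenberg (energy Φ Λ') t a) (heisenberg (energy Φ Λ') t b)
    (heisenberg (energy Φ Λ) t b) (heisenberg (energy Φ Λ) t a)
  have h4 := hΛ Λ' hΛ'
  linarith

theorem tendsto_bulk [Nonempty S] (h : IsDecaying L f f₀ C M N Φ) (hL : IsLocalNet L) (t : ℝ)
    (a : A) : Tendsto (fun Λ => heisenberg (energy Φ Λ) t a) atTop (𝓝 (bulk Φ t a)) :=
  (h.cauchySeq_heisenberg hL t a).tendsto_limUnder

/-- Isometry makes the evolutions equicontinuous. This joint limit is what carries the group law to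
infinite volume. -/
theorem tendsto_bulk_of_tendsto [Nonempty S] (h : IsDecaying L f f₀ C M N Φ)
    (hL : IsLocalNet L) (t : ℝ) {a : A} {u : Finset S → A} (hu : Tendsto u atTop (𝓝 a)) :
    Tendsto (fun Λ => heisenberg (energy Φ Λ) t (u Λ)) atTop (𝓝 (bulk Φ t a)) := by
  have h1 : Tendsto (fun Λ => heisenberg (energy Φ Λ) t (u Λ - a)) atTop (𝓝 0) := by
    rw [tendsto_zero_iff_norm_tendsto_zero]
    simp only [norm_heisenberg (h.energy_selfAdjoint _)]
    exact tendsto_iff_norm_sub_tendsto_zero.mp hu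
  simpa [heisenberg_sub] using h1.add (h.tendsto_bulk hL t a)

theorem bulk_zero [Nonempty S] (h : IsDecaying L f f₀ C M N Φ) (hL : IsLocalNet L) (a : A) :
    bulk Φ 0 a = a :=
  tendsto_nhds_unique (h.tendsto_bulk hL 0 a) (by simp)

theorem bulk_add [Nonempty S] (h : IsDecaying L f f₀ C M N Φ) (hL : IsLocalNet L) (s t : ℝ)
    (a : A) : bulk Φ (s + t) a = bulk Φ s (bulk Φ t a) :=
  tendsto_nhds_unique (h.tendsto_bulk hL (s + t) a) (by
    simp only [heisenberg_add]
    exact h.tendsto_bulk_of_tendsto hL s (h.tendsto_bulk hL t a))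

theorem norm_bulk [Nonempty S] (h : IsDecaying L f f₀ C M N Φ) (hL : IsLocalNet L) (t : ℝ)
    (a : A) : ‖bulk Φ t a‖ = ‖a‖ :=
  tendsto_nhds_unique (h.tendsto_bulk hL t a).norm (by
    simp only [norm_heisenberg (h.energy_selfAdjoint _)]
    exact tendsto_const_nhds)

/-- The infinite-volume dynamics as a group of automorphisms. -/
def bulkAut [Nonempty S] (h : IsDecaying L f f₀ C M N Φ) (hL : IsLocalNet L) (t : ℝ) :
    A ≃⋆ₐ[ℂ] A where
  toFun := bulk Φ t
  invFun := bulk Φ (-t)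
  left_inv a := by
    rw [← h.bulk_add hL, neg_add_cancel, h.bulk_zero hL]
  right_inv a := by
    rw [← h.bulk_add hL, add_neg_cancel, h.bulk_zero hL]
  map_mul' a b := tendsto_nhds_unique (h.tendsto_bulk hL t (a * b)) (by
    simpa only [← heisenbergAut_apply (h.energy_selfAdjoint _), map_mul] using
      (h.tendsto_bulk hL t a).mul (h.tendsto_bulk hL t b))
  map_add' a b := tendsto_nhds_unique (h.tendsto_bulk hL t (a + b)) (by
    simpa only [← heisenbergAut_apply (h.energy_selfAdjoint _), map_add] using
      (h.tendsto_bulk hL t a).add (h.tendsto_bulk hL t b))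
  map_star' a := tendsto_nhds_unique (h.tendsto_bulk hL t (star a)) (by
    simpa only [← heisenbergAut_apply (h.energy_selfAdjoint _), map_star] using
      (h.tendsto_bulk hL t a).star)
  map_smul' z a := tendsto_nhds_unique (h.tendsto_bulk hL t (z • a)) (by
    simpa only [← heisenbergAut_apply (h.energy_selfAdjoint _), map_smul] using
      (h.tendsto_bulk hL t a).const_smul z)

theorem bulk_sub [Nonempty S] (h : IsDecaying L f f₀ C M N Φ) (hL : IsLocalNet L) (t : ℝ)
    (a b : A) : bulk Φ t (a - b) = bulk Φ t a - bulk Φ t b :=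
  map_sub (h.bulkAut hL t) a b

theorem summable_norm_lie (h : IsDecaying L f f₀ C M N Φ) (hL : IsLocalNet L)
    {X : Finset S} {b : A} (hb : b ∈ L X) : Summable fun Z => ‖⁅Φ Z, b⁆‖ := by
  refine Summable.of_nonneg_of_le (fun Z => norm_nonneg _)
    (fun Z => h.norm_lie_le_weight hL (h.mem Z) hb) ?_
  simpa only [mul_assoc, mul_comm, mul_left_comm] using
    (h.summable_weight X).mul_left (2 * ‖b‖ / f₀)

theorem hasSum_bulkDeriv (h : IsDecaying L f f₀ C M N Φ) (hL : IsLocalNet L)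
    {X : Finset S} {b : A} (hb : b ∈ L X) :
    HasSum (fun Z => I • ⁅Φ Z, b⁆) (bulkDeriv Φ b) :=
  (Summable.of_norm (h.summable_norm_lie hL hb)).const_smul I |>.hasSum

omit [DecidableEq S] in
theorem lie_energy (Φ : Finset S → A) (Λ : Finset S) (b : A) :
    I • ⁅energy Φ Λ, b⁆ = ∑ Z ∈ Λ.powerset, I • ⁅Φ Z, b⁆ := by
  simp only [energy, Ring.lie_def, Finset.sum_mul, Finset.mul_sum, ← Finset.sum_sub_distrib,
    Finset.smul_sum]

theorem tendsto_bulkDeriv (h : IsDecaying L f f₀ C M N Φ) (hL : IsLocalNet L)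
    {X : Finset S} {b : A} (hb : b ∈ L X) :
    Tendsto (fun Λ => I • ⁅energy Φ Λ, b⁆) atTop (𝓝 (bulkDeriv Φ b)) := by
  simp only [lie_energy]
  exact (h.hasSum_bulkDeriv hL hb).comp tendsto_finset_powerset_atTop_atTop

theorem norm_bulk_sub_self_le [Nonempty S] (h : IsDecaying L f f₀ C M N Φ) (hL : IsLocalNet L)
    {X : Finset S} {b : A} (hb : b ∈ L X) (t : ℝ) :
    ‖bulk Φ t b - b‖ ≤ ‖bulkDeriv Φ b‖ * |t| := by
  refine le_of_tendsto_of_tendsto' ((h.tendsto_bulk hL t b).sub_const b).norm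
    ((h.tendsto_bulkDeriv hL hb).norm.mul_const |t|) fun Λ => ?_
  refine (norm_heisenberg_sub_self_le (h.energy_selfAdjoint Λ) t b).trans_eq ?_
  simp [norm_smul]

/-- Local observables move at speed at most `‖bulkDeriv Φ b‖`; density and isometry give continuity
at time zero for every observable. -/
theorem continuous_bulk [Nonempty S] (h : IsDecaying L f f₀ C M N Φ) (hL : IsLocalNet L)
    (a : A) : Continuous fun t => bulk Φ t a := by
  have h0 : Tendsto (fun t => ‖bulk Φ t a - a‖) (𝓝 0) (𝓝 0) := by
    refine Metric.tendsto_nhds.mpr fun ε hε => ?_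
    obtain ⟨X, b, hb, hab⟩ := hL.exists_mem_norm_sub_lt a (by positivity : 0 < ε / 3)
    have h1 : Tendsto (fun t : ℝ => ‖bulkDeriv Φ b‖ * |t|) (𝓝 0) (𝓝 0) := by
      have : Continuous fun t : ℝ => ‖bulkDeriv Φ b‖ * |t| := by fun_prop
      simpa using this.tendsto 0
    filter_upwards [h1.eventually (gt_mem_nhds (by positivity : 0 < ε / 3))] with t ht
    have h2 := h.norm_bulk_sub_self_le hL hb t
    have h3 : bulk Φ t a - a = bulk Φ t (a - b) + (bulk Φ t b - b) + (b - a) := by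
      rw [h.bulk_sub hL]
      abel
    have h4 : ‖bulk Φ t a - a‖ ≤ ‖a - b‖ + ‖bulk Φ t b - b‖ + ‖a - b‖ := by
      rw [h3]
      refine (norm_add₃_le).trans_eq ?_
      rw [h.norm_bulk hL, norm_sub_rev b a]
    rw [dist_zero_right, norm_norm]
    linarith
  rw [continuous_iff_continuousAt]
  intro s
  rw [ContinuousAt, tendsto_iff_norm_sub_tendsto_zero]
  -- The group law and isometry move continuity at `0` to any time `s`.
  have h1 : ∀ t, ‖bulk Φ t a - bulk Φ s a‖ = ‖bulk Φ (t - s) a - a‖ := fun t => by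
    rw [← h.norm_bulk hL s (bulk Φ (t - s) a - a), h.bulk_sub hL, ← h.bulk_add hL,
      add_sub_cancel]
  simp only [h1]
  refine h0.comp ?_
  have h2 : Continuous fun t : ℝ => t - s := by fun_prop
  simpa using h2.tendsto s

end IsDecaying

end Bulk

/-! ### States of a `C^*`-algebra -/

section States

variable {A : Type*} [CStarAlgebra A]

/-- States of a unital `C^*`-algebra. -/
def IsPositiveState (φ : WeakDual ℂ A) : Prop := (∀ a, 0 ≤ φ (star a * a)) ∧ φ 1 = 1

namespace IsPositiveState

variable {φ : WeakDual ℂ A}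

/-- Hermiticity, the Cauchy-Schwarz inequality and contractivity. -/
theorem hermitian_and_bounds (hφ : IsPositiveState φ) (a : A) :
    φ (star a) = star (φ a) ∧
      (∀ b, ‖φ (star b * a)‖ ≤ √(φ (star b * b)).re * √(φ (star a * a)).re) ∧ ‖φ a‖ ≤ ‖a‖ := by
  let _ : PartialOrder A := CStarAlgebra.spectralOrder A
  have _ : StarOrderedRing A := CStarAlgebra.spectralOrderedRing A
  let g : A →ₗ[ℂ] ℂ := (φ : A →L[ℂ] ℂ).toLinearMap
  let f : A →ₚ[ℂ] ℂ := PositiveLinearMap.mk₀ g fun x hx => by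
    obtain ⟨b, rfl⟩ := CStarAlgebra.nonneg_iff_eq_star_mul_self.mp hx
    exact hφ.1 b
  have hf : ∀ x, f x = φ x := fun _ => rfl
  -- Cauchy-Schwarz for the GNS semi-inner product of `φ`; the choice `b = 1` below gives
  -- contractivity.
  have hcs : ∀ b, ‖φ (star b * a)‖ ≤ √(φ (star b * b)).re * √(φ (star a * a)).re := fun b => by
    have hinner := norm_inner_le_norm (𝕜 := ℂ) (f.toPreGNS b) (f.toPreGNS a)
    rwa [PositiveLinearMap.preGNS_inner_def, PositiveLinearMap.preGNS_norm_def,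
      PositiveLinearMap.preGNS_norm_def] at hinner
  refine ⟨by simpa only [hf] using StarHomClass.map_star f a, hcs, ?_⟩
  have hinner := hcs 1
  simp only [star_one, one_mul, hφ.2, one_re, Real.sqrt_one] at hinner
  refine hinner.trans (Real.sqrt_le_iff.mpr ⟨norm_nonneg _, ?_⟩)
  refine (Complex.re_le_norm _).trans ?_
  refine (PositiveLinearMap.norm_apply_le_of_nonneg f _ (star_mul_self_nonneg a)).trans ?_
  have : f 1 = 1 := hφ.2
  rw [this, norm_one, one_mul, CStarRing.norm_star_mul_self, sq]

theorem map_star (hφ : IsPositiveState φ) (a : A) : φ (star a) = star (φ a) :=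
  (hφ.hermitian_and_bounds a).1

theorem norm_le (hφ : IsPositiveState φ) (a : A) : ‖φ a‖ ≤ ‖a‖ :=
  (hφ.hermitian_and_bounds a).2.2

theorem apply_star_mul_eq_zero (hφ : IsPositiveState φ) {a : A} (ha : φ (star a * a) = 0)
    (b : A) : φ (star a * b) = 0 := by
  have := (hφ.hermitian_and_bounds b).2.1 a
  rw [ha] at this
  simpa using this

theorem im_eq_zero (hφ : IsPositiveState φ) {a : A} (ha : IsSelfAdjoint a) : (φ a).im = 0 := by
  have := hφ.map_star a
  rw [ha.star_eq] at this
  exact Complex.conj_eq_iff_im.mp this.symm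

/-- Convergence of values along weak-* convergent states and norm convergent observables. -/
theorem tendsto_apply {ι : Type*} {l : Filter ι} {lam : ι → WeakDual ℂ A}
    (hlam : ∀ i, IsPositiveState (lam i)) (hφ : Tendsto lam l (𝓝 φ)) {u : ι → A} {x : A}
    (hu : Tendsto u l (𝓝 x)) : Tendsto (fun i => lam i (u i)) l (𝓝 (φ x)) := by
  have h1 : Tendsto (fun i => lam i (u i - x)) l (𝓝 0) :=
    squeeze_zero_norm (fun i => (hlam i).norm_le _) (tendsto_iff_norm_sub_tendsto_zero.mp hu)
  have h2 : Tendsto (fun i => lam i x) l (𝓝 (φ x)) :=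
    ((WeakDual.eval_continuous x).tendsto φ).comp hφ
  simpa using h1.add h2

theorem of_tendsto {ι : Type*} {l : Filter ι} [l.NeBot] {lam : ι → WeakDual ℂ A}
    (hlam : ∀ i, IsPositiveState (lam i)) (hφ : Tendsto lam l (𝓝 φ)) : IsPositiveState φ := by
  have h : ∀ x, Tendsto (fun i => lam i x) l (𝓝 (φ x)) := fun x =>
    tendsto_apply hlam hφ tendsto_const_nhds
  refine ⟨fun a => ge_of_tendsto' (h _) fun i => (hlam i).1 a, ?_⟩
  refine tendsto_nhds_unique (h 1) ?_
  simp only [(hlam _).2]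
  exact tendsto_const_nhds

/-- A state that minimises the energy among all states is a ground state. -/
theorem nonneg_of_minimal (hφ : IsPositiveState φ) {H : A} (hH : IsSelfAdjoint H)
    (hmin : ∀ ψ : WeakDual ℂ A, IsPositiveState ψ → (φ H).re ≤ (ψ H).re) (a : A) :
    0 ≤ φ (star a * ⁅H, a⁆) := by
  set e : ℝ := (φ H).re
  set T : A := H - algebraMap ℂ A e with hT
  have hTs : IsSelfAdjoint T := by
    refine hH.sub ?_
    rw [IsSelfAdjoint, ← algebraMap_star_comm]
    simp
  have hsa : ∀ x, IsSelfAdjoint (star x * T * x) := fun x => by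
    rw [IsSelfAdjoint, star_mul, star_mul, star_star, hTs.star_eq, mul_assoc]
  -- Minimality is tested against the states `y ↦ φ(x* y x) / φ(x* x)`; if the denominator vanishes,
  -- the form vanishes too by Cauchy-Schwarz.
  have hq : ∀ x, 0 ≤ (φ (star x * T * x)).re := by
    intro x
    have hx := hφ.1 x
    have hxr : φ (star x * x) = ((φ (star x * x)).re : ℂ) := (Complex.eq_re_of_ofReal_le hx)
    set r := (φ (star x * x)).re with hr
    have hr0 : 0 ≤ r := (Complex.le_def.mp hx).1
    have hTx : φ (star x * T * x) = φ (star x * H * x) - e * r := by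
      rw [hT, mul_sub, sub_mul, map_sub, ← Algebra.commutes, mul_assoc (algebraMap ℂ A _),
        ← Algebra.smul_def, map_smul, hxr, smul_eq_mul]
    rcases hr0.eq_or_lt with h0 | hpos
    · have hT0 : φ (star x * T * x) = 0 := by
        rw [mul_assoc]
        exact hφ.apply_star_mul_eq_zero (by rw [hxr, ← h0, Complex.ofReal_zero]) _
      rw [hT0]
      simp
    · let ψ : WeakDual ℂ A := ((r : ℂ)⁻¹ •
        ((φ : A →L[ℂ] ℂ).comp ((ContinuousLinearMap.mul ℂ A (star x)).comp
          ((ContinuousLinearMap.mul ℂ A).flip x))) : A →L[ℂ] ℂ)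
      have hψ : ∀ y, ψ y = (r : ℂ)⁻¹ * φ (star x * (y * x)) := fun y => rfl
      have hψs : IsPositiveState ψ := by
        refine ⟨fun y => ?_, ?_⟩
        · rw [hψ]
          refine mul_nonneg ?_ ?_
          · exact_mod_cast inv_nonneg.mpr hr0
          · have := hφ.1 (y * x)
            simpa only [star_mul, mul_assoc] using this
        · rw [hψ, one_mul, hxr]
          exact inv_mul_cancel₀ (by exact_mod_cast hpos.ne')
      have := hmin ψ hψs
      rw [hψ, ← mul_assoc, ← Complex.ofReal_inv, Complex.re_ofReal_mul] at this
      rw [hTx, Complex.sub_re, ← Complex.ofReal_mul, Complex.ofReal_re]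
      have h2 := mul_le_mul_of_nonneg_left this hr0
      rw [← mul_assoc r, mul_inv_cancel₀ hpos.ne', one_mul] at h2
      linarith
  have hqr : ∀ x, φ (star x * T * x) = ((φ (star x * T * x)).re : ℂ) := fun x =>
    (Complex.ext rfl (by simpa using hφ.im_eq_zero (hsa x)))
  have hT1 : φ T = 0 := by
    rw [hT, map_sub, Algebra.algebraMap_eq_smul_one, map_smul, hφ.2]
    exact Complex.ext (by simp [e]) (by simpa using hφ.im_eq_zero hH)
  -- The nonnegative form `x ↦ φ(x* T x)` vanishes at `1`, so `1` lies in its kernel. This is seen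
  -- by perturbing `1` in the direction of `x`.
  have hlin : ∀ x, φ (T * x) = 0 := by
    intro x
    set w := φ (T * x) with hw
    by_contra hne
    set q := (φ (star x * T * x)).re
    have hxT : φ (star x * T) = star w := by
      rw [hw, ← hφ.map_star, star_mul, hTs.star_eq]
    have hexp : ∀ s : ℝ, 0 ≤ -2 * s * ‖w‖ ^ 2 + s ^ 2 * ‖w‖ ^ 2 * q := by
      intro s
      have h1 := hq (1 - ((s : ℂ) * star w) • x)
      have h2 : φ (star (1 - ((s : ℂ) * star w) • x) * T * (1 - ((s : ℂ) * star w) • x))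
          = φ T - (s : ℂ) * star w * w - (s : ℂ) * w * star w
            + (s : ℂ) ^ 2 * (w * star w) * φ (star x * T * x) := by
        rw [star_sub, star_smul, star_one, star_mul', star_star]
        simp only [sub_mul, mul_sub, one_mul, mul_one, smul_mul_assoc, mul_smul_comm, map_sub,
          map_smul, smul_eq_mul, hxT, ← hw]
        simp
        ring
      have h3 : w * star w = ((‖w‖ ^ 2 : ℝ) : ℂ) := by
        rw [Complex.star_def, Complex.mul_conj, Complex.normSq_eq_norm_sq]
      rw [h2, hT1, mul_assoc _ (star w) w, mul_comm (star w) w, mul_assoc _ w (star w), h3,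
        hqr x] at h1
      have h4 : (0 - (s : ℂ) * ((‖w‖ ^ 2 : ℝ) : ℂ) - (s : ℂ) * ((‖w‖ ^ 2 : ℝ) : ℂ)
          + (s : ℂ) ^ 2 * ((‖w‖ ^ 2 : ℝ) : ℂ) * (q : ℂ))
          = ((-2 * s * ‖w‖ ^ 2 + s ^ 2 * ‖w‖ ^ 2 * q : ℝ) : ℂ) := by
        push_cast
        ring
      rwa [h4, Complex.ofReal_re] at h1
    have hw2 : 0 < ‖w‖ ^ 2 := by positivity
    have hq0 : 0 ≤ q := hq x
    -- For this `s` the expression equals `-‖w‖² (q + 2) / (q + 1)²`, which is negative unless `w =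
    -- 0`.
    have h5 := hexp (1 / (q + 1))
    have h6 : -2 * (1 / (q + 1)) * ‖w‖ ^ 2 + (1 / (q + 1)) ^ 2 * ‖w‖ ^ 2 * q
        = -(‖w‖ ^ 2 * (q + 2)) / (q + 1) ^ 2 := by
      field_simp
      ring
    rw [h6] at h5
    have h7 : 0 < ‖w‖ ^ 2 * (q + 2) / (q + 1) ^ 2 := by positivity
    rw [neg_div] at h5
    linarith
  have h1 : ⁅H, a⁆ = T * a - a * T := by
    rw [Ring.lie_def, hT, sub_mul, mul_sub, Algebra.commutes]
    abel
  -- The complex conjugate of `φ(T a* a) = 0`; only the nonnegative part `φ(a* T a)` of the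
  -- commutator remains.
  have h2 : φ (star a * (a * T)) = 0 := by
    have := hφ.map_star (T * (star a * a))
    rw [hlin, star_zero, star_mul, star_mul, star_star, hTs.star_eq, mul_assoc] at this
    exact this
  rw [h1, mul_sub, map_sub, h2, sub_zero, ← mul_assoc, hqr a]
  exact_mod_cast hq a

end IsPositiveState

end States

/-! ### Limits of finite-volume ground states -/

section GroundStates

variable {A : Type*} [CStarAlgebra A] {S : Type*} [DecidableEq S]

variable {L : Finset S → StarSubalgebra ℂ A} {f : S → S → ℝ} {f₀ C M N : ℝ} {Φ : Finset S → A}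

omit [DecidableEq S] in
-- A local algebra is closed and convex, so it contains the average of `u`, hence also the integral.
-- Time averages of local observables are thus legitimate test elements in finite volume.
theorem IsLocalNet.intervalIntegral_mem (hL : IsLocalNet L) {Λ : Finset S} {u : ℝ → A}
    (hu : Continuous u) (hmem : ∀ s, u s ∈ L Λ) {ε : ℝ} (hε : 0 < ε) :
    ∫ s in 0..ε, u s ∈ L Λ := by
  have hconv : Convex ℝ (L Λ : Set A) := by
    intro x hx y hy a b _ _ _
    rw [← Complex.coe_smul a x, ← Complex.coe_smul b y]
    exact add_mem (SMulMemClass.smul_mem _ hx) (SMulMemClass.smul_mem _ hy)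
  have h1 : ⨍ s in (0 : ℝ)..ε, u s ∈ (L Λ : Set A) := by
    refine hconv.set_average_mem (hL.closed Λ) ?_ ?_ (Eventually.of_forall hmem) ?_
    · simp [Set.uIoc_of_le hε.le, hε]
    · simp [Set.uIoc_of_le hε.le]
    · exact (hu.intervalIntegrable 0 ε).def'
  rw [interval_average_eq, sub_zero, SetLike.mem_coe] at h1
  have h2 := SMulMemClass.smul_mem (ε : ℂ) h1
  rwa [Complex.coe_smul, smul_inv_smul₀ hε.ne'] at h2

/-- The time averages of the Heisenberg evolution lie in the domain of its generator. -/
theorem lie_integral_heisenberg (H b : A) (ε : ℝ) :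
    I • ⁅H, ∫ s in 0..ε, heisenberg H s b⁆ = heisenberg H ε b - b := by
  have hc : Continuous fun s => heisenberg H s b :=
    continuous_iff_continuousAt.mpr fun s => (hasDerivAt_heisenberg H b s).continuousAt
  let T : A →L[ℂ] A :=
    I • (ContinuousLinearMap.mul ℂ A H - (ContinuousLinearMap.mul ℂ A).flip H)
  have hT : ∀ x, T x = I • ⁅H, x⁆ := fun x => rfl
  have hd : ∀ s, HasDerivAt (fun u => heisenberg H u b) (T (heisenberg H s b)) s := fun s => by
    have := hasDerivAt_heisenberg H b s
    rwa [heisenberg_lie_self] at this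
  rw [← hT, ← T.intervalIntegral_comp_comm (hc.intervalIntegrable 0 ε),
    intervalIntegral.integral_eq_sub_of_hasDerivAt (fun s _ => hd s)
      ((T.continuous.comp hc).intervalIntegrable 0 ε), heisenberg_zero]

namespace IsDecaying

variable {Λ : ℕ → Finset S} {lam : ℕ → WeakDual ℂ A} {φ : WeakDual ℂ A} {U : Filter ℕ}
  [U.NeBot]

/-- The commutators converge in norm and the states weak-*, and states are uniformly bounded, so the
pairing converges. -/
theorem nonneg_bulkDeriv_of_tendsto (h : IsDecaying L f f₀ C M N Φ) (hL : IsLocalNet L)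
    (hΛ : Tendsto Λ atTop atTop) (hU : U ≤ atTop) (hlam : ∀ n, IsPositiveState (lam n))
    (hground : ∀ n, ∀ b ∈ L (Λ n), 0 ≤ -I * lam n (star b * (I • ⁅energy Φ (Λ n), b⁆)))
    (hφ : Tendsto lam U (𝓝 φ)) {X : Finset S} {b : A} (hb : b ∈ L X) :
    0 ≤ -I * φ (star b * bulkDeriv Φ b) := by
  have h1 : Tendsto (fun n => -I * lam n (star b * (I • ⁅energy Φ (Λ n), b⁆))) U
      (𝓝 (-I * φ (star b * bulkDeriv Φ b))) :=
    (IsPositiveState.tendsto_apply hlam hφ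
      (((h.tendsto_bulkDeriv hL hb).comp (hΛ.mono_left hU)).const_mul (star b))).const_mul _
  refine ge_of_tendsto h1 ?_
  filter_upwards [(hΛ.mono_left hU).eventually_ge_atTop X] with n hn
  exact hground n b (hL.mono hn hb)

/-- The finite-volume condition is applied to the time average of the evolution of `b`, whose
derivative is a difference of two evolved observables. Everything in it converges in norm. -/
theorem nonneg_integral_bulk_of_mem [Nonempty S] (h : IsDecaying L f f₀ C M N Φ)
    (hL : IsLocalNet L)
    (hΛ : Tendsto Λ atTop atTop) (hU : U ≤ atTop) (hlam : ∀ n, IsPositiveState (lam n))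
    (hground : ∀ n, ∀ b ∈ L (Λ n), 0 ≤ -I * lam n (star b * (I • ⁅energy Φ (Λ n), b⁆)))
    (hφ : Tendsto lam U (𝓝 φ)) {X : Finset S} {b : A} (hb : b ∈ L X) {ε : ℝ} (hε : 0 < ε) :
    0 ≤ -I * φ (star (∫ s in 0..ε, bulk Φ s b) * (bulk Φ ε b - b)) := by
  have hc : ∀ n, Continuous fun s => heisenberg (energy Φ (Λ n)) s b := fun n =>
    continuous_iff_continuousAt.mpr fun s => (hasDerivAt_heisenberg _ b s).continuousAt
  have h1 : Tendsto (fun n => ∫ s in 0..ε, heisenberg (energy Φ (Λ n)) s b) atTop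
      (𝓝 (∫ s in 0..ε, bulk Φ s b)) :=
    intervalIntegral.tendsto_integral_filter_of_dominated_convergence (fun _ => ‖b‖)
      (Eventually.of_forall fun n => (hc n).aestronglyMeasurable)
      (Eventually.of_forall fun n => Eventually.of_forall fun s _ =>
        (norm_heisenberg (h.energy_selfAdjoint _) s b).le)
      intervalIntegrable_const
      (Eventually.of_forall fun s _ => (h.tendsto_bulk hL s b).comp hΛ)
  have h2 : Tendsto (fun n => heisenberg (energy Φ (Λ n)) ε b - b) atTop
      (𝓝 (bulk Φ ε b - b)) := ((h.tendsto_bulk hL ε b).comp hΛ).sub_const b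
  have h3 := (IsPositiveState.tendsto_apply hlam hφ
    ((h1.star.mul h2).mono_left hU)).const_mul (-I)
  refine ge_of_tendsto h3 ?_
  filter_upwards [(hΛ.mono_left hU).eventually_ge_atTop X] with n hn
  rw [← lie_integral_heisenberg]
  exact hground n _ (hL.intervalIntegral_mem (hc n)
    (fun s => hL.heisenberg_mem (h.energy_mem hL _) (hL.mono hn hb) s) hε)

/-- Both the average and the difference are Lipschitz in `b`, so the inequality extends from the
dense local observables. No domain condition on `b` appears. -/
theorem nonneg_integral_bulk [Nonempty S] (h : IsDecaying L f f₀ C M N Φ)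
    (hL : IsLocalNet L)
    (hΛ : Tendsto Λ atTop atTop) (hU : U ≤ atTop) (hlam : ∀ n, IsPositiveState (lam n))
    (hground : ∀ n, ∀ b ∈ L (Λ n), 0 ≤ -I * lam n (star b * (I • ⁅energy Φ (Λ n), b⁆)))
    (hφ : Tendsto lam U (𝓝 φ)) (b : A) {ε : ℝ} (hε : 0 < ε) :
    0 ≤ -I * φ (star (∫ s in 0..ε, bulk Φ s b) * (bulk Φ ε b - b)) := by
  have hint : ∀ b, IntervalIntegrable (fun s => bulk Φ s b) volume 0 ε := fun b =>
    (h.continuous_bulk hL b).intervalIntegrable 0 ε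
  have hc1 : Continuous fun b => bulk Φ ε b := by
    refine (LipschitzWith.of_dist_le_mul (K := 1) fun x y => ?_).continuous
    rw [dist_eq_norm, dist_eq_norm, ← h.bulk_sub hL, h.norm_bulk hL]
    simp
  have hc2 : Continuous fun b => ∫ s in 0..ε, bulk Φ s b := by
    refine (LipschitzWith.of_dist_le_mul (K := ε.toNNReal) fun x y => ?_).continuous
    rw [dist_eq_norm, dist_eq_norm, ← intervalIntegral.integral_sub (hint x) (hint y)]
    simp only [← h.bulk_sub hL]
    refine (intervalIntegral.norm_integral_le_of_norm_le_const (C := ‖x - y‖) fun s _ =>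
      (h.norm_bulk hL s _).le).trans_eq ?_
    rw [sub_zero, abs_of_pos hε, Real.coe_toNNReal _ hε.le, mul_comm]
  have hcl : IsClosed {b | 0 ≤ -I * φ (star (∫ s in 0..ε, bulk Φ s b) * (bulk Φ ε b - b))} := by
    refine isClosed_le continuous_const (continuous_const.mul ?_)
    exact (φ : A →L[ℂ] ℂ).continuous.comp (hc2.star.mul (hc1.sub continuous_id))
  refine hcl.closure_subset_iff.mpr ?_ (hL.dense b)
  intro x hx
  obtain ⟨X, hX⟩ := Set.mem_iUnion.mp hx
  exact h.nonneg_integral_bulk_of_mem hL hΛ hU hlam hground hφ hX hε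

theorem nonneg_of_hasDerivAt_bulk [Nonempty S] (h : IsDecaying L f f₀ C M N Φ)
    (hL : IsLocalNet L)
    (hΛ : Tendsto Λ atTop atTop) (hU : U ≤ atTop) (hlam : ∀ n, IsPositiveState (lam n))
    (hground : ∀ n, ∀ b ∈ L (Λ n), 0 ≤ -I * lam n (star b * (I • ⁅energy Φ (Λ n), b⁆)))
    (hφ : Tendsto lam U (𝓝 φ)) {b d : A} (hd : HasDerivAt (fun t => bulk Φ t b) d 0) :
    0 ≤ -I * φ (star b * d) := by
  have hc := h.continuous_bulk hL b
  have h1 : HasDerivAt (fun u => ∫ s in 0..u, bulk Φ s b) (bulk Φ 0 b) 0 :=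
    intervalIntegral.integral_hasDerivAt_right (hc.intervalIntegrable 0 0)
      (hc.stronglyMeasurableAtFilter _ _) hc.continuousAt
  have h2 := h1.tendsto_slope_zero_right
  have h3 := hd.tendsto_slope_zero_right
  simp only [zero_add, intervalIntegral.integral_same, sub_zero, h.bulk_zero hL] at h2 h3
  -- The average divided by `ε` tends to `b` and the difference quotient to `d`; the positive factor
  -- `ε⁻²` preserves the sign.
  have h4 := (((φ : A →L[ℂ] ℂ).continuous.tendsto _).comp (h2.star.mul h3)).const_mul (-I)
  refine ge_of_tendsto h4 ?_
  filter_upwards [self_mem_nhdsWithin] with ε hε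
  have h5 := h.nonneg_integral_bulk hL hΛ hU hlam hground hφ b hε
  simp only [Function.comp, star_smul, star_trivial, smul_mul_assoc, mul_smul_comm]
  have h6 : ∀ x : A, φ (ε⁻¹ • ε⁻¹ • x) = ((ε⁻¹ * ε⁻¹ : ℝ) : ℂ) * φ x := fun x => by
    rw [smul_smul, ← Complex.coe_smul, map_smul, smul_eq_mul]
  change 0 ≤ -I * φ _
  rw [h6, mul_left_comm]
  refine mul_nonneg ?_ h5
  exact_mod_cast mul_self_nonneg _

end IsDecaying

end GroundStates

/-! ### Measurable selection of convergent subsequences -/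

section Selection

variable {Ω : Type*} [MeasurableSpace Ω]

/-- The indices that survive the first `i` refinements of the sequence of indices, where the
`i`-th refinement decides the events `B i`. -/
def survivors (B : ℕ → ℕ → Set Ω) : ℕ → ℕ → Set Ω
  | 0, _ => Set.univ
  | i + 1, m => {ω | ω ∈ survivors B i m ∧
      (ω ∈ B i m ↔ ∃ᶠ l in atTop, ω ∈ survivors B i l ∧ ω ∈ B i l)}

variable {B : ℕ → ℕ → Set Ω}

/-- Whether infinitely many surviving indices lie in `B i` is a countable combination of measurable
events. -/
theorem measurableSet_survivors (hB : ∀ i m, MeasurableSet (B i m)) (i m : ℕ) :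
    MeasurableSet (survivors B i m) := by
  induction i generalizing m with
  | zero => exact MeasurableSet.univ
  | succ i ih =>
    have h1 : MeasurableSet {ω | ∃ᶠ l in atTop, ω ∈ survivors B i l ∧ ω ∈ B i l} := by
      simp only [frequently_atTop]
      refine measurableSet_setOfPred.mpr ?_
      refine Measurable.forall fun a => Measurable.exists fun b => ?_
      exact Measurable.and measurable_const
        (((ih b).inter (hB i b)).mem)
    exact (ih m).inter (measurableSet_setOfPred.mpr ((hB i m).mem.iff h1.mem))

omit [MeasurableSpace Ω] in
theorem survivors_antitone (B : ℕ → ℕ → Set Ω) (m : ℕ) : Antitone fun i => survivors B i m :=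
  antitone_nat_of_succ_le fun _ _ hω => hω.1

omit [MeasurableSpace Ω] in
-- A refinement keeps the indices in `B i` if there are infinitely many of them and the others if
-- not; either way infinitely many remain.
theorem frequently_mem_survivors (B : ℕ → ℕ → Set Ω) (i : ℕ) (ω : Ω) :
    ∃ᶠ m in atTop, ω ∈ survivors B i m := by
  induction i with
  | zero => exact Frequently.of_forall fun _ => trivial
  | succ i ih =>
    by_cases h : ∃ᶠ l in atTop, ω ∈ survivors B i l ∧ ω ∈ B i l
    · exact h.mono fun m hm => ⟨hm.1, by simp [h, hm.2]⟩
    · refine (ih.and_eventually (not_frequently.mp h)).mono fun m hm => ⟨hm.1, ?_⟩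
      exact iff_of_false (fun hB => hm.2 ⟨hm.1, hB⟩) h

omit [MeasurableSpace Ω] in
theorem exists_lt_mem_survivors (B : ℕ → ℕ → Set Ω) (i : ℕ) (s : Ω → ℕ) (ω : Ω) :
    ∃ m, s ω < m ∧ ω ∈ survivors B i m := by
  obtain ⟨m, hm, h⟩ := frequently_atTop.mp (frequently_mem_survivors B i ω) (s ω + 1)
  exact ⟨m, hm, h⟩

open Classical in
/-- Random indices along which each of the events `B i` is eventually decided. -/
def decidedIndex (B : ℕ → ℕ → Set Ω) : ℕ → Ω → ℕ
  | 0 => fun _ => 0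
  | n + 1 => fun ω => Nat.find (exists_lt_mem_survivors B (n + 1) (decidedIndex B n) ω)

omit [MeasurableSpace Ω] in
theorem decidedIndex_spec (B : ℕ → ℕ → Set Ω) (n : ℕ) (ω : Ω) :
    decidedIndex B n ω < decidedIndex B (n + 1) ω ∧
      ω ∈ survivors B (n + 1) (decidedIndex B (n + 1) ω) := by
  classical
  exact Nat.find_spec (exists_lt_mem_survivors B (n + 1) (decidedIndex B n) ω)

theorem measurable_decidedIndex (hB : ∀ i m, MeasurableSet (B i m)) (n : ℕ) :
    Measurable (decidedIndex B n) := by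
  classical
  induction n with
  | zero => exact measurable_const
  | succ n ih =>
    refine measurable_find _ fun m => ?_
    exact (ih (measurableSet_Iio (a := m))).inter (measurableSet_survivors hB (n + 1) m)

omit [MeasurableSpace Ω] in
theorem strictMono_decidedIndex (B : ℕ → ℕ → Set Ω) (ω : Ω) :
    StrictMono fun n => decidedIndex B n ω :=
  strictMono_nat_of_lt_succ fun n => (decidedIndex_spec B n ω).1

omit [MeasurableSpace Ω] in
-- The `n`-th index survives the first `n` refinements, so from `n = i + 1` on all indices agree
-- about `B i`.
theorem eventually_decided (B : ℕ → ℕ → Set Ω) (i : ℕ) (ω : Ω) :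
    (∀ᶠ n in atTop, ω ∈ B i (decidedIndex B n ω)) ∨
      ∀ᶠ n in atTop, ω ∉ B i (decidedIndex B n ω) := by
  have h : ∀ᶠ n in atTop, ω ∈ survivors B (i + 1) (decidedIndex B n ω) := by
    filter_upwards [eventually_ge_atTop (i + 1)] with n hn
    obtain ⟨n, rfl⟩ := Nat.exists_eq_add_of_le' (Nat.one_le_of_lt hn)
    exact survivors_antitone B _ hn (decidedIndex_spec B n ω).2
  by_cases hf : ∃ᶠ l in atTop, ω ∈ survivors B i l ∧ ω ∈ B i l
  · exact Or.inl (h.mono fun n hn => hn.2.mpr hf)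
  · exact Or.inr (h.mono fun n hn hB => hf (hn.2.mp hB))

/-! ### Compactness of the state space and measurable limits of states -/

variable {A : Type*} [CStarAlgebra A]

/-- Banach-Alaoglu: states have norm at most one, and their defining conditions are weak-* closed.
-/
theorem isCompact_setOf_isPositiveState : IsCompact {φ : WeakDual ℂ A | IsPositiveState φ} := by
  refine (WeakDual.isCompact_closedBall (𝕜 := ℂ) (0 : StrongDual ℂ A) 1).of_isClosed_subset ?_ ?_
  · have : {φ : WeakDual ℂ A | IsPositiveState φ}
        = (⋂ a : A, {φ | 0 ≤ φ (star a * a)}) ∩ {φ | φ 1 = 1} := by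
      ext φ
      simp [IsPositiveState]
    rw [this]
    exact (isClosed_iInter fun a =>
      isClosed_le continuous_const (WeakDual.eval_continuous _)).inter
        (isClosed_eq (WeakDual.eval_continuous _) continuous_const)
  · intro φ hφ
    simp only [Set.mem_preimage, Metric.mem_closedBall, dist_zero_right]
    exact ContinuousLinearMap.opNorm_le_bound _ zero_le_one fun a => by
      simpa using IsPositiveState.norm_le hφ a

theorem tendsto_weakDual_iff {ι : Type*} {l : Filter ι} {u : ι → WeakDual ℂ A}
    {φ : WeakDual ℂ A} : Tendsto u l (𝓝 φ) ↔ ∀ a, Tendsto (fun i => u i a) l (𝓝 (φ a)) :=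
  tendsto_iff_forall_eval_tendsto_topDualPairing

theorem measurable_apply_nat {E : Type*} [MeasurableSpace E] {g : ℕ → Ω → E}
    (hg : ∀ n, Measurable (g n)) {σ : Ω → ℕ} (hσ : Measurable σ) :
    Measurable fun ω => g (σ ω) ω :=
  (measurable_from_prod_countable_right (f := fun p : ℕ × Ω => g p.1 p.2) hg).comp
    (hσ.prodMk measurable_id)

/-- The events decided are that the value at a point of a dense sequence lies in a member of a
countable basis of `ℂ`. Deciding them all forces weak-* convergence. -/
theorem exists_measurable_convergent_subsequence [TopologicalSpace.SeparableSpace A]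
    (lam : ℕ → Ω → WeakDual ℂ A) (hmeas : ∀ n a, Measurable fun ω => lam n ω a)
    (hlam : ∀ n ω, IsPositiveState (lam n ω)) :
    ∃ (Γ : Ω → WeakDual ℂ A) (σ : ℕ → Ω → ℕ), (∀ ω, IsPositiveState (Γ ω)) ∧
      (∀ a, Measurable fun ω => Γ ω a) ∧ (∀ n, Measurable (σ n)) ∧
      ∀ ω, StrictMono (fun n => σ n ω) ∧ Tendsto (fun n => lam (σ n ω) ω) atTop (𝓝 (Γ ω)) := by
  obtain ⟨b, hbc, -, hb⟩ := TopologicalSpace.exists_countable_basis ℂ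
  have hbne : b.Nonempty := by
    obtain ⟨s, hs, -⟩ := hb.exists_subset_of_mem_open (Set.mem_univ (0 : ℂ)) isOpen_univ
    exact ⟨s, hs⟩
  obtain ⟨V, rfl⟩ := hbc.exists_eq_range hbne
  set d := TopologicalSpace.denseSeq A
  set B : ℕ → ℕ → Set Ω := fun i m =>
    {ω | lam m ω (d i.unpair.1) ∈ V i.unpair.2}
  have hB : ∀ i m, MeasurableSet (B i m) := fun i m =>
    hmeas m _ (hb.isOpen ⟨_, rfl⟩).measurableSet
  set σ := decidedIndex B
  have hconv : ∀ ω, ∃ φ, Tendsto (fun n => lam (σ n ω) ω) atTop (𝓝 φ) := by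
    intro ω
    obtain ⟨φ, hφ, hcl⟩ := isCompact_setOf_isPositiveState.exists_mapClusterPt
      (f := atTop) (u := fun n => lam (σ n ω) ω)
      (le_principal_iff.mpr (mem_map.mpr (Eventually.of_forall fun n => hlam _ ω)))
    have h1 : ∀ j, Tendsto (fun n => lam (σ n ω) ω (d j)) atTop (𝓝 (φ (d j))) := by
      intro j
      refine hb.nhds_hasBasis.tendsto_right_iff.mpr ?_
      rintro _ ⟨⟨i, rfl⟩, hi⟩
      have h2 := eventually_decided B (Nat.pair j i) ω
      simp only [B, Set.mem_ofPred_eq, Nat.unpair_pair] at h2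
      -- A cluster point visits each neighbourhood infinitely often, so a decided neighbourhood is
      -- never eventually avoided.
      refine h2.resolve_right fun h3 => ?_
      have h4 : ∃ᶠ n in atTop, lam (σ n ω) ω (d j) ∈ V i := by
        refine hcl.frequently (p := fun ψ => ψ (d j) ∈ V i) ?_
        exact (WeakDual.eval_continuous (d j)).continuousAt.eventually_mem
          ((hb.isOpen ⟨i, rfl⟩).mem_nhds hi)
      exact h4 h3
    refine ⟨φ, tendsto_weakDual_iff.mpr fun a => Metric.tendsto_nhds.mpr fun ε hε => ?_⟩
    obtain ⟨_, ⟨j, rfl⟩, hj⟩ := Metric.mem_closure_iff.mp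
      (TopologicalSpace.denseRange_denseSeq A a) (ε / 3) (by positivity)
    have hj' : ‖a - d j‖ < ε / 3 := by rwa [← dist_eq_norm]
    filter_upwards [Metric.tendsto_nhds.mp (h1 j) (ε / 3) (by positivity)] with n hn
    have h5 := ((hlam (σ n ω) ω).norm_le (a - d j)).trans_lt hj'
    have h6 := (IsPositiveState.norm_le hφ (a - d j)).trans_lt hj'
    rw [map_sub, ← dist_eq_norm] at h5 h6
    rw [dist_comm] at h6
    have := dist_triangle4 (lam (σ n ω) ω a) (lam (σ n ω) ω (d j)) (φ (d j)) (φ a)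
    linarith
  choose Γ hΓ using hconv
  refine ⟨Γ, σ, fun ω => IsPositiveState.of_tendsto (fun n => hlam (σ n ω) ω) (hΓ ω),
    fun a => ?_, measurable_decidedIndex hB, fun ω => ⟨strictMono_decidedIndex B ω, hΓ ω⟩⟩
  -- The limit is measurable although it was chosen pointwise, because its values are limits of
  -- measurable functions.
  refine measurable_of_tendsto_metrizable (f := fun n ω => lam (σ n ω) ω a)
    (fun n => measurable_apply_nat (fun m => hmeas m a) (measurable_decidedIndex hB n)) ?_
  exact tendsto_pi_nhds.mpr fun ω => tendsto_weakDual_iff.mp (hΓ ω) a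

/-! ### Measurable minimisers of the energy -/

open Classical in
/-- The running minimisers of the energy `H` among the first states of a sequence. -/
def runningMinimizer (e : ℕ → WeakDual ℂ A) (H : Ω → A) : ℕ → Ω → WeakDual ℂ A
  | 0, _ => e 0
  | m + 1, ω => if (e (m + 1) (H ω)).re < (runningMinimizer e H m ω (H ω)).re then
      e (m + 1) else runningMinimizer e H m ω

omit [MeasurableSpace Ω] in
theorem runningMinimizer_isPositiveState {e : ℕ → WeakDual ℂ A}
    (he : ∀ j, IsPositiveState (e j)) (H : Ω → A) (m : ℕ) (ω : Ω) :
    IsPositiveState (runningMinimizer e H m ω) := by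
  induction m with
  | zero => exact he 0
  | succ m ih =>
    rw [runningMinimizer]
    split_ifs
    exacts [he _, ih]

theorem measurable_runningMinimizer (e : ℕ → WeakDual ℂ A) {H : Ω → A}
    (hH : ∀ φ : WeakDual ℂ A, Measurable fun ω => φ (H ω)) (m : ℕ) :
    (∀ a, Measurable fun ω => runningMinimizer e H m ω a) ∧
      Measurable fun ω => runningMinimizer e H m ω (H ω) := by
  classical
  induction m with
  | zero => exact ⟨fun a => measurable_const (a := e 0 a), hH (e 0)⟩
  | succ m ih =>
    have hs : MeasurableSet
        {ω | (e (m + 1) (H ω)).re < (runningMinimizer e H m ω (H ω)).re} :=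
      measurableSet_lt (measurable_re.comp (hH _)) (measurable_re.comp ih.2)
    have hval : ∀ ω a, runningMinimizer e H (m + 1) ω a =
        if (e (m + 1) (H ω)).re < (runningMinimizer e H m ω (H ω)).re then
          e (m + 1) a else runningMinimizer e H m ω a := fun ω a => by
      rw [runningMinimizer]
      split_ifs <;> rfl
    simp only [hval]
    exact ⟨fun a => Measurable.ite hs measurable_const (ih.1 a),
      Measurable.ite hs (hH (e (m + 1))) ih.2⟩

omit [MeasurableSpace Ω] in
theorem runningMinimizer_le (e : ℕ → WeakDual ℂ A) (H : Ω → A) (ω : Ω) {j m : ℕ} (hj : j ≤ m) :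
    (runningMinimizer e H m ω (H ω)).re ≤ (e j (H ω)).re := by
  induction m, hj using Nat.le_induction with
  | base =>
    cases j with
    | zero => exact le_rfl
    | succ j =>
      rw [runningMinimizer]
      split_ifs with h
      exacts [le_rfl, not_lt.mp h]
  | succ m _ ih =>
    rw [runningMinimizer]
    split_ifs with h
    exacts [h.le.trans ih, ih]

/-- Measurable choice of a state of minimal energy. -/
theorem exists_measurable_minimal_state [TopologicalSpace.SeparableSpace A]
    (hne : ∃ φ : WeakDual ℂ A, IsPositiveState φ) {H : Ω → A}
    (hH : ∀ φ : WeakDual ℂ A, Measurable fun ω => φ (H ω)) :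
    ∃ Γ : Ω → WeakDual ℂ A, (∀ a, Measurable fun ω => Γ ω a) ∧ ∀ ω, IsPositiveState (Γ ω) ∧
      ∀ ψ : WeakDual ℂ A, IsPositiveState ψ → (Γ ω (H ω)).re ≤ (ψ (H ω)).re := by
  let K : Set (WeakDual ℂ A) := {φ | IsPositiveState φ}
  have hK : IsCompact K := isCompact_setOf_isPositiveState
  have : CompactSpace K := isCompact_iff_compactSpace.mp hK
  have : TopologicalSpace.MetrizableSpace K := WeakDual.metrizable_of_isCompact ℂ A K hK
  let _ := TopologicalSpace.metrizableSpaceMetric K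
  have : Nonempty K := let ⟨φ, hφ⟩ := hne; ⟨⟨φ, hφ⟩⟩
  let e : ℕ → WeakDual ℂ A := fun j => (TopologicalSpace.denseSeq K j : WeakDual ℂ A)
  have he : ∀ j, IsPositiveState (e j) := fun j => (TopologicalSpace.denseSeq K j).2
  -- The running minimisers over a dense sequence of states need not converge; a measurable limit
  -- point lies below every state of the sequence, hence below all states.
  obtain ⟨Γ, σ, hΓ, hΓm, -, hσ⟩ := exists_measurable_convergent_subsequence
    (runningMinimizer e H) (fun m => (measurable_runningMinimizer e hH m).1)
    (runningMinimizer_isPositiveState he H)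
  refine ⟨Γ, hΓm, fun ω => ⟨hΓ ω, fun ψ hψ => ?_⟩⟩
  have hj : ∀ j, (Γ ω (H ω)).re ≤ (e j (H ω)).re := fun j => by
    refine le_of_tendsto ((Complex.continuous_re.tendsto _).comp
      (tendsto_weakDual_iff.mp (hσ ω).2 (H ω))) ?_
    filter_upwards [eventually_ge_atTop j] with n hn
    exact runningMinimizer_le e H ω (hn.trans (hσ ω).1.le_apply)
  have hcl : IsClosed {φ : K | (Γ ω (H ω)).re ≤ ((φ : WeakDual ℂ A) (H ω)).re} :=
    isClosed_le continuous_const (Complex.continuous_re.comp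
      ((WeakDual.eval_continuous (H ω)).comp continuous_subtype_val))
  have hsub : Set.range (TopologicalSpace.denseSeq K)
      ⊆ {φ : K | (Γ ω (H ω)).re ≤ ((φ : WeakDual ℂ A) (H ω)).re} := by
    rintro _ ⟨j, rfl⟩
    exact hj j
  exact hcl.closure_subset_iff.mpr hsub
    (TopologicalSpace.denseRange_denseSeq K (⟨ψ, hψ⟩ : K))

end Selection

variable {ν k : ℕ}

/-! ### The quasi-local algebra as a net of local algebras -/

theorem isClosed_quasiLocal : IsClosed (quasiLocal ν k : Set (ConfigOp ν k)) :=
  StarSubalgebra.isClosed_topologicalClosure _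

attribute [local instance] isClosed_quasiLocal

theorem overwrite_comm {X Y : Finset (Site ν)} (hXY : Disjoint X Y) (u : LocalConfig k X)
    (v : LocalConfig k Y) (s : Config ν k) :
    overwrite X u (overwrite Y v s) = overwrite Y v (overwrite X u s) := by
  funext x
  by_cases hX : x ∈ X
  · have hY : x ∉ Y := Finset.disjoint_left.mp hXY hX
    simp [overwrite, hX, hY]
  · simp [overwrite, hX]

theorem restr_overwrite_of_disjoint {X Y : Finset (Site ν)} (hXY : Disjoint X Y)
    (u : LocalConfig k X) (s : Config ν k) : restr Y (overwrite X u s) = restr Y s := by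
  funext x
  have hX : (x : Site ν) ∉ X := Finset.disjoint_right.mp hXY x.2
  simp [restr, overwrite, hX]

theorem localRep_commute {X Y : Finset (Site ν)} (hXY : Disjoint X Y)
    (m : Matrix (LocalConfig k X) (LocalConfig k X) ℂ)
    (n : Matrix (LocalConfig k Y) (LocalConfig k Y) ℂ) :
    Commute (localRep X m) (localRep Y n) := by
  ext ψ s
  simp only [mul_apply_eq_comp, localRep_apply, restr_overwrite_of_disjoint hXY,
    restr_overwrite_of_disjoint hXY.symm, Finset.mul_sum]
  rw [Finset.sum_comm]
  refine Finset.sum_congr rfl fun v _ => Finset.sum_congr rfl fun u _ => ?_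
  rw [overwrite_comm hXY]
  ring

theorem isClosed_localOpAlgebra (X : Finset (Site ν)) :
    IsClosed (localOpAlgebra ν k X : Set (ConfigOp ν k)) := by
  have : (localOpAlgebra ν k X : Set (ConfigOp ν k))
      = (LinearMap.range (localRep (k := k) X).toAlgHom.toLinearMap : Set (ConfigOp ν k)) := by
    ext T
    exact Iff.rfl
  rw [this]
  exact Submodule.closed_of_finiteDimensional _

theorem isLocalNet_localAlgebra : IsLocalNet (localAlgebra ν k) where
  mono hXY _ ha := localOpAlgebra_mono hXY ha
  commute := by
    rintro X Y hXY a ⟨m, hm⟩ b ⟨n, hn⟩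
    have := localRep_commute (k := k) hXY m n
    refine Subtype.ext ?_
    change (a : ConfigOp ν k) * b = b * a
    have hm' : localRep X m = (a : ConfigOp ν k) := hm
    have hn' : localRep Y n = (b : ConfigOp ν k) := hn
    rw [← hm', ← hn']
    exact this
  dense a := by
    rw [Metric.mem_closure_iff]
    intro ε hε
    obtain ⟨b, hb, hab⟩ := Metric.mem_closure_iff.mp
      (show (a : ConfigOp ν k) ∈ closure (locOpAlgebra ν k : Set (ConfigOp ν k)) from a.2) ε hε
    obtain ⟨X, hX⟩ := Set.mem_iUnion.mp hb
    exact ⟨⟨b, subset_closure hb⟩, Set.mem_iUnion.mpr ⟨X, hX⟩, hab⟩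
  closed X := (isClosed_localOpAlgebra X).preimage continuous_subtype_val

/-- There are countably many finite volumes, and each local algebra is finite-dimensional. -/
theorem separableSpace_obs : TopologicalSpace.SeparableSpace (Obs ν k) := by
  have h1 : ∀ X, TopologicalSpace.IsSeparable (localOpAlgebra ν k X : Set (ConfigOp ν k)) := by
    intro X
    have hc : Continuous (localRep (k := k) X : _ → ConfigOp ν k) :=
      (localRep (k := k) X).toAlgHom.toLinearMap.continuous_of_finiteDimensional
    have : TopologicalSpace.SeparableSpace (Matrix (LocalConfig k X) (LocalConfig k X) ℂ) :=
      inferInstanceAs (TopologicalSpace.SeparableSpace (LocalConfig k X → LocalConfig k X → ℂ))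
    have : (localOpAlgebra ν k X : Set (ConfigOp ν k)) = Set.range (localRep (k := k) X) := by
      ext T
      exact Iff.rfl
    rw [this]
    exact TopologicalSpace.isSeparable_range hc
  have h2 : TopologicalSpace.IsSeparable (quasiLocal ν k : Set (ConfigOp ν k)) :=
    (TopologicalSpace.IsSeparable.iUnion h1).closure
  exact h2.separableSpace

attribute [local instance] separableSpace_obs

/-- The vector state of the constant configuration `0`. -/
theorem exists_isState [NeZero k] : ∃ φ : WeakDual ℂ (Obs ν k), IsPositiveState φ := by
  classical
  let ψ : ConfigSpace ν k := lp.single 2 (fun _ => 0 : Config ν k) (1 : ℂ)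
  have hψ : ‖ψ‖ = 1 := by
    rw [lp.norm_single (by norm_num)]
    simp
  let φ : Obs ν k →L[ℂ] ℂ := (innerSL ℂ ψ).comp
    ((ContinuousLinearMap.apply ℂ (ConfigSpace ν k) ψ).comp (quasiLocal ν k).toSubalgebra.toSubmodule.subtypeL)
  have hφ : ∀ a : Obs ν k, φ a = inner ℂ ψ ((a : ConfigOp ν k) ψ) := fun a => rfl
  refine ⟨(φ : Obs ν k →L[ℂ] ℂ), fun a => ?_, ?_⟩
  · change 0 ≤ φ (star a * a)
    rw [hφ]
    change 0 ≤ inner ℂ ψ ((star (a : ConfigOp ν k) * (a : ConfigOp ν k)) ψ)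
    rw [mul_apply_eq_comp, ContinuousLinearMap.star_eq_adjoint,
      ContinuousLinearMap.adjoint_inner_right, inner_self_eq_norm_sq_to_K]
    exact pow_nonneg (Complex.zero_le_real.mpr (norm_nonneg ((a : ConfigOp ν k) ψ))) 2
  · change φ 1 = 1
    rw [hφ]
    change inner ℂ ψ ψ = (1 : ℂ)
    rw [inner_self_eq_norm_sq_to_K, hψ]
    simp

/-! ### Deterministic interactions -/

theorem localDynamics_eq_heisenberg (Φ : Finset (Site ν) → Obs ν k) (Λ : Finset (Site ν))
    (t : ℝ) (a : Obs ν k) : localDynamics Φ Λ t a = heisenberg (energy Φ Λ) t a := by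
  simp [localDynamics, propagator, heisenberg, energy, hamiltonian]

theorem IsLocalGroundState.nonneg {Φ : Finset (Site ν) → Obs ν k} {Λ : Finset (Site ν)}
    {φ : WeakDual ℂ (Obs ν k)} (hφ : IsLocalGroundState Φ Λ φ) {b : Obs ν k}
    (hb : b ∈ localAlgebra ν k Λ) : 0 ≤ -I * φ (star b * (I • ⁅energy Φ Λ, b⁆)) := by
  refine hφ.2 b hb _ ?_
  simp only [localDynamics_eq_heisenberg]
  simpa using hasDerivAt_heisenberg (energy Φ Λ) b 0

theorem isLocalGroundState_of_minimal {Φ : Finset (Site ν) → Obs ν k}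
    (hΦ : ∀ Z, IsSelfAdjoint (Φ Z)) {Λ : Finset (Site ν)} {φ : WeakDual ℂ (Obs ν k)}
    (hφ : IsPositiveState φ) (hmin : ∀ ψ : WeakDual ℂ (Obs ν k), IsPositiveState ψ →
      (φ (energy Φ Λ)).re ≤ (ψ (energy Φ Λ)).re) : IsLocalGroundState Φ Λ φ := by
  refine ⟨hφ, fun a _ d hd => ?_⟩
  have h1 : d = I • ⁅energy Φ Λ, a⁆ := by
    refine hd.unique ?_
    simp only [localDynamics_eq_heisenberg]
    simpa using hasDerivAt_heisenberg (energy Φ Λ) a 0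
  have h2 := hφ.nonneg_of_minimal (isSelfAdjoint_sum _ fun Z _ => hΦ Z) hmin a
  rw [h1, mul_smul_comm, map_smul, smul_eq_mul, ← mul_assoc]
  simpa [energy] using h2

/-- The kernel is `F(d(x, y))` and the coupling constant is the `F`-norm itself; extended sums
become bounds on finite partial sums. -/
theorem isDecaying_of_fNorm_lt_top {F : ℝ → ℝ} (hF : IsFFunction ν F)
    {Φ : Finset (Site ν) → Obs ν k} (hΦ : IsInteraction Φ) (hfin : fNorm F Φ < ∞) :
    ∃ f₀ C M N : ℝ, IsDecaying (localAlgebra ν k) (fun x y => F (dist x y)) f₀ C M N Φ := by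
  have hpos : ∀ x y : Site ν, 0 < F (dist x y) := fun x y => hF.pos _ dist_nonneg
  obtain ⟨C, hC, hconv⟩ := hF.convolution
  set M := ⨆ x : Site ν, ∑' y : Site ν, ENNReal.ofReal (F (dist x y)) with hM
  refine ⟨F 0, C, M.toReal, (fNorm F Φ).toReal, fun Z => (hΦ Z).1, fun Z => (hΦ Z).2, hpos,
    fun x => by simp, hF.pos 0 le_rfl, hC.le, ENNReal.toReal_nonneg, ?_, ?_, ?_⟩
  · intro W x y
    have h1 := (ENNReal.sum_le_tsum W).trans (hconv x y)
    rw [← ENNReal.ofReal_sum_of_nonneg fun z _ => (mul_pos (hpos _ _) (hpos _ _)).le] at h1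
    exact (ENNReal.ofReal_le_ofReal_iff (mul_pos hC (hpos x y)).le).mp h1
  · intro W y
    have h1 := (ENNReal.sum_le_tsum W).trans
      (le_iSup (fun x : Site ν => ∑' y : Site ν, ENNReal.ofReal (F (dist x y))) y)
    rw [← ENNReal.ofReal_sum_of_nonneg fun z _ => (hpos _ _).le,
      ENNReal.ofReal_le_iff_le_toReal hF.summable.ne] at h1
    simpa only [dist_comm] using h1
  · intro Λ x z
    have h1 : ∑' Z : {Z : Finset (Site ν) // x ∈ Z ∧ z ∈ Z},
        ‖Φ Z‖ₑ / ENNReal.ofReal (F (dist x z)) ≤ fNorm F Φ :=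
      le_iSup₂ (f := fun x y => ∑' Z : {Z : Finset (Site ν) // x ∈ Z ∧ y ∈ Z},
        ‖Φ Z‖ₑ / ENNReal.ofReal (F (dist x y))) x z
    have h2 := (ENNReal.sum_le_tsum
      (Λ.powerset.subtype fun Z : Finset (Site ν) => x ∈ Z ∧ z ∈ Z)).trans h1
    rw [Finset.sum_subtype_eq_sum_filter (f := fun Z : Finset (Site ν) =>
      ‖Φ Z‖ₑ / ENNReal.ofReal (F (dist x z)))] at h2
    have hF0 : ENNReal.ofReal (F (dist x z)) ≠ 0 := (ENNReal.ofReal_pos.mpr (hpos x z)).ne'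
    simp only [div_eq_mul_inv] at h2
    rw [← Finset.sum_mul, ← div_eq_mul_inv,
      ENNReal.div_le_iff hF0 ENNReal.ofReal_ne_top] at h2
    have h3 := ENNReal.toReal_mono (ENNReal.mul_ne_top hfin.ne ENNReal.ofReal_ne_top) h2
    rw [ENNReal.toReal_mul, ENNReal.toReal_ofReal (hpos x z).le,
      ENNReal.toReal_sum fun Z _ => enorm_ne_top] at h3
    simpa using h3

theorem IsIAS.tendsto_atTop {Λ : ℕ → Finset (Site ν)} (hΛ : IsIAS Λ) :
    Tendsto Λ atTop atTop :=
  tendsto_atTop_finset_of_monotone hΛ.1 hΛ.2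

theorem isBulkGroundState_of_mapClusterPt {F : ℝ → ℝ} (hF : IsFFunction ν F)
    {Φ : Finset (Site ν) → Obs ν k} (hΦ : IsInteraction Φ) (hfin : fNorm F Φ < ∞)
    {Λ : ℕ → Finset (Site ν)} (hΛ : IsIAS Λ) {lam : ℕ → WeakDual ℂ (Obs ν k)}
    (hlam : ∀ n, IsLocalGroundState Φ (Λ n) (lam n)) {φ : WeakDual ℂ (Obs ν k)}
    (hφ : MapClusterPt φ atTop lam) : IsBulkGroundState Φ φ := by
  obtain ⟨f₀, C, M, N, h⟩ := isDecaying_of_fNorm_lt_top hF hΦ hfin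
  -- An ultrafilter turns the limit point into a genuine limit, without assuming that a subsequence
  -- converges.
  obtain ⟨U, hU, hφU⟩ := mapClusterPt_iff_ultrafilter.mp hφ
  have hL : IsLocalNet (localAlgebra ν k) := isLocalNet_localAlgebra
  have hst : ∀ n, IsPositiveState (lam n) := fun n => (hlam n).1
  have hgr : ∀ n, ∀ b ∈ localAlgebra ν k (Λ n),
      0 ≤ -I * lam n (star b * (I • ⁅energy Φ (Λ n), b⁆)) := fun n b hb => (hlam n).nonneg hb
  refine ⟨⟨h.bulkAut hL, ⟨h.bulk_zero hL, h.bulk_add hL, h.continuous_bulk hL, ?_⟩,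
    IsPositiveState.of_tendsto hst hφU, ?_⟩, ?_⟩
  · intro t X a _
    simp only [localDynamics_eq_heisenberg]
    exact h.tendsto_bulk hL t a
  · intro a _ d hd
    exact h.nonneg_of_hasDerivAt_bulk hL hΛ.tendsto_atTop hU hst hgr hφU hd
  · intro X a ha
    refine ⟨bulkDeriv Φ a, ?_,
      h.nonneg_bulkDeriv_of_tendsto hL hΛ.tendsto_atTop hU hst hgr hφU ha⟩
    -- By locality only the sets meeting `X` contribute to the generator.
    have hsupp : Function.support (fun Z => I • ⁅Φ Z, a⁆)
        ⊆ {Z : Finset (Site ν) | ∃ x ∈ Z, x ∈ X} := by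
      intro Z hZ
      by_contra hd
      have hdis : Disjoint Z X := Finset.disjoint_left.mpr fun x hx hX => hd ⟨x, hx, hX⟩
      refine hZ ?_
      change I • ⁅Φ Z, a⁆ = 0
      rw [Ring.lie_def, (hL.commute hdis _ (h.mem Z) a ha).eq, sub_self, smul_zero]
    have h1 := (hasSum_subtype_iff_of_support_subset hsupp).mpr (h.hasSum_bulkDeriv hL ha)
    have h2 : (fun Z : {Z : Finset (Site ν) // ∃ x ∈ Z, x ∈ X} =>
        (I • Φ Z) * a - a * (I • Φ Z)) = (fun Z => I • ⁅Φ Z, a⁆) ∘ Subtype.val := by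
      funext Z
      simp [Ring.lie_def, smul_sub]
    rw [h2]
    exact h1

/-! ### Random interactions -/

section Random

variable {Ω : Type*} [MeasurableSpace Ω]

/-- In a separable space the norm is a supremum over countably many functionals, each norming a
point of a dense sequence. -/
theorem measurable_enorm_of_weak {E : Type*} [NormedAddCommGroup E] [NormedSpace ℂ E]
    [TopologicalSpace.SeparableSpace E] {u : Ω → E}
    (hu : ∀ φ : WeakDual ℂ E, Measurable fun ω => φ (u ω)) : Measurable fun ω => ‖u ω‖ₑ := by
  set d := TopologicalSpace.denseSeq E
  choose g hg1 hg2 using fun j => exists_dual_vector'' ℂ (d j)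
  have hle : ∀ j x, ‖g j x‖ ≤ ‖x‖ := fun j x => by
    simpa using (g j).le_of_opNorm_le (hg1 j) x
  have key : ∀ x : E, ‖x‖ₑ = ⨆ j, ‖g j x‖ₑ := by
    intro x
    refine le_antisymm ?_ (iSup_le fun j => by
      rw [enorm_le_iff_norm_le]
      exact hle j x)
    refine ENNReal.le_of_forall_pos_le_add fun ε hε _ => ?_
    -- The distance `‖x - d j‖` is paid twice, in passing from `x` to `d j` and back, hence `ε / 2`.
    obtain ⟨_, ⟨j, rfl⟩, hj⟩ := Metric.mem_closure_iff.mp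
      (TopologicalSpace.denseRange_denseSeq E x) (ε / 2) (by positivity)
    refine le_trans ?_ (add_le_add_left (le_iSup (fun j => ‖g j x‖ₑ) j) _)
    have h1 : ‖x‖ ≤ ‖g j x‖ + ε := by
      have h2 : ‖d j‖ ≤ ‖g j x‖ + ‖x - d j‖ := by
        have h3 : ‖g j (d j)‖ = ‖d j‖ := by
          rw [hg2 j]
          simp
        have h4 : g j (d j) = g j x - g j (x - d j) := by simp
        rw [← h3, h4]
        exact (norm_sub_le _ _).trans (add_le_add_right (hle j _) _)
      have h5 : ‖x‖ ≤ ‖d j‖ + ‖x - d j‖ := by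
        simpa using norm_add_le (d j) (x - d j)
      rw [dist_eq_norm] at hj
      linarith
    rw [← ofReal_norm, ← ofReal_norm, ← ENNReal.ofReal_coe_nnreal,
      ← ENNReal.ofReal_add (norm_nonneg _) ε.coe_nonneg]
    exact ENNReal.ofReal_le_ofReal h1
  simp only [key]
  exact Measurable.iSup fun j => (hu (g j : E →L[ℂ] ℂ)).enorm

theorem measurable_fNorm (F : ℝ → ℝ) {P : Measure Ω} {h : Ω → Finset (Site ν) → Obs ν k}
    (hh : IsDisorderedInteraction P h) : Measurable fun ω => fNorm F (h ω) := by
  unfold fNorm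
  exact Measurable.iSup fun x => Measurable.iSup fun y => Measurable.tsum fun Z =>
    (measurable_enorm_of_weak (hh.measurable Z)).div_const _

/-! ### Translation invariance and ergodicity -/

theorem norm_translate (x : Site ν) (a : Obs ν k) : ‖translate x a‖ = ‖a‖ := by
  change ‖translateOp x (a : ConfigOp ν k)‖ = ‖(a : ConfigOp ν k)‖
  rw [translateOp, Unitary.conjStarAlgAut_apply, ← Unitary.coe_star,
    CStarRing.norm_mul_coe_unitary, CStarRing.norm_coe_unitary_mul]

theorem translateVol_eq_finsetCongr (x : Site ν) (Z : Finset (Site ν)) :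
    translateVol x Z = (Equiv.addRight x).finsetCongr Z := by
  ext y
  simp [translateVol, ← eq_sub_iff_add_eq, sub_eq_add_neg]

/-- Translations are isometric on observables and on the lattice, so the suprema and sums are merely
reindexed. -/
theorem fNorm_eq_of_covariant (F : ℝ → ℝ) {Φ Ψ : Finset (Site ν) → Obs ν k} (x : Site ν)
    (hΦ : ∀ Z, translate x (Φ Z) = Ψ (translateVol x Z)) : fNorm F Ψ = fNorm F Φ := by
  unfold fNorm
  refine (Equiv.iSup_congr (Equiv.addRight x) fun y => ?_).symm
  refine (Equiv.iSup_congr (Equiv.addRight x) fun z => ?_).symm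
  let e : {Z : Finset (Site ν) // y ∈ Z ∧ z ∈ Z} ≃
      {Z : Finset (Site ν) // Equiv.addRight x y ∈ Z ∧ Equiv.addRight x z ∈ Z} :=
    (Equiv.addRight x).finsetCongr.subtypeEquiv fun Z => by simp
  rw [← e.tsum_eq]
  refine tsum_congr fun Z => ?_
  have h1 : ((e Z : Finset (Site ν))) = translateVol x Z :=
    (translateVol_eq_finsetCongr x Z).symm
  have h2 : ‖Ψ (e Z)‖ₑ = ‖Φ Z‖ₑ := by
    rw [h1, ← hΦ, ← ofReal_norm, norm_translate, ofReal_norm]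
  rw [h2]
  simp

/-- Finiteness is invariant up to null sets, so by ergodicity it holds almost surely or almost
never. -/
theorem ae_fNorm_lt_top (F : ℝ → ℝ) {P : Measure Ω} {h : Ω → Finset (Site ν) → Obs ν k}
    (hh : IsErgodicInteraction P h) (hpos : 0 < P {ω | fNorm F (h ω) < ∞}) :
    ∀ᵐ ω ∂P, fNorm F (h ω) < ∞ := by
  obtain ⟨hd, act, _, herg, hcov⟩ := hh
  have hinv : ∀ x : Site ν, (x +ᵥ · : Ω → Ω) ⁻¹' {ω | fNorm F (h ω) < ∞}
      =ᵐ[P] {ω | fNorm F (h ω) < ∞} := by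
    intro x
    filter_upwards [ae_all_iff.mpr (hcov x)] with ω hω
    have := fNorm_eq_of_covariant F x hω
    exact propext (by
      change fNorm F (h (x +ᵥ ω)) < ∞ ↔ fNorm F (h ω) < ∞
      rw [this])
  have hc := herg.aeconst_of_forall_preimage_vadd_ae_eq
    (measurable_fNorm F hd measurableSet_Iio) hinv
  rcases eventuallyConst_set.mp hc with h1 | h1
  · exact h1
  · exact absurd (measure_eq_zero_iff_ae_notMem.mpr h1) hpos.ne'

theorem ae_isInteraction {P : Measure Ω} {h : Ω → Finset (Site ν) → Obs ν k}
    (hh : IsDisorderedInteraction P h) : ∀ᵐ ω ∂P, IsInteraction (h ω) :=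
  ae_all_iff.mpr hh.interaction

theorem exists_disordered_groundState [NeZero k] {P : Measure Ω} {F : ℝ → ℝ}
    (hF : IsFFunction ν F) {h : Ω → Finset (Site ν) → Obs ν k} (hh : IsErgodicInteraction P h)
    {Λ : ℕ → Finset (Site ν)} (hΛ : IsIAS Λ) (hpos : 0 < P {ω | fNorm F (h ω) < ∞})
    (lam : ℕ → Ω → WeakDual ℂ (Obs ν k)) (hmeas : ∀ n, IsWeakStarMeasurable (lam n))
    (hlam : ∀ n, ∀ᵐ ω ∂P, IsLocalGroundState (h ω) (Λ n) (lam n ω)) :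
    ∃ (Γ : Ω → WeakDual ℂ (Obs ν k)) (σ : ℕ → Ω → ℕ),
      IsDisorderedGroundState P h Γ ∧ (∀ n, Measurable (σ n)) ∧
      ∀ᵐ ω ∂P, StrictMono (fun n => σ n ω) ∧
        Tendsto (fun n => lam (σ n ω) ω) atTop (𝓝 (Γ ω)) ∧ IsBulkGroundState (h ω) (Γ ω) := by
  classical
  obtain ⟨φ₀, hφ₀⟩ := exists_isState (ν := ν) (k := k)
  have hgood : ∀ᵐ ω ∂P, (∀ n, IsLocalGroundState (h ω) (Λ n) (lam n ω)) ∧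
      IsInteraction (h ω) ∧ fNorm F (h ω) < ∞ :=
    (ae_all_iff.mpr hlam).and ((ae_isInteraction hh.1).and (ae_fNorm_lt_top F hh hpos))
  -- A disordered ground state must be a state for every `ω`; on the null set outside `G` the fixed
  -- state `φ₀` is used, and measurability of `G` keeps the modification measurable.
  obtain ⟨G, hG, hGm, hGsub⟩ := hgood.exists_measurable_mem
  let lam' : ℕ → Ω → WeakDual ℂ (Obs ν k) := fun n ω => if ω ∈ G then lam n ω else φ₀
  have hst : ∀ n ω, IsPositiveState (lam' n ω) := fun n ω => by
    by_cases hω : ω ∈ G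
    · simp only [lam', if_pos hω]
      exact ((hGsub ω hω).1 n).1
    · simpa only [lam', if_neg hω] using hφ₀
  have hm : ∀ n a, Measurable fun ω => lam' n ω a := fun n a => by
    have h1 : (fun ω => lam' n ω a) = fun ω => if ω ∈ G then lam n ω a else φ₀ a := by
      funext ω
      simp only [lam']
      split_ifs <;> rfl
    rw [h1]
    exact Measurable.ite hGm (hmeas n a) measurable_const
  obtain ⟨Γ, σ, hΓ, hΓm, hσm, hσ⟩ := exists_measurable_convergent_subsequence lam' hm hst
  have hfinal : ∀ᵐ ω ∂P, StrictMono (fun n => σ n ω) ∧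
      Tendsto (fun n => lam (σ n ω) ω) atTop (𝓝 (Γ ω)) ∧ IsBulkGroundState (h ω) (Γ ω) := by
    filter_upwards [hG] with ω hω
    have ht : Tendsto (fun n => lam (σ n ω) ω) atTop (𝓝 (Γ ω)) := by
      simpa only [lam', if_pos hω] using (hσ ω).2
    obtain ⟨h1, h2, h3⟩ := hGsub ω hω
    refine ⟨(hσ ω).1, ht, isBulkGroundState_of_mapClusterPt hF h2 h3 hΛ h1 ?_⟩
    exact MapClusterPt.of_comp (φ := fun n => σ n ω) (hσ ω).1.tendsto_atTop ht.mapClusterPt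
  exact ⟨Γ, σ, ⟨hΓ, hΓm, hfinal.mono fun ω hω => hω.2.2.2⟩, hσm, hfinal⟩

/-- Minimisers of the local energy are ground states and can be chosen measurably. -/
theorem exists_measurable_local_groundStates [NeZero k] {P : Measure Ω}
    {h : Ω → Finset (Site ν) → Obs ν k} (hh : IsDisorderedInteraction P h)
    (Λ : Finset (Site ν)) : ∃ lam : Ω → WeakDual ℂ (Obs ν k), IsWeakStarMeasurable lam ∧
      ∀ᵐ ω ∂P, IsLocalGroundState (h ω) Λ (lam ω) := by
  obtain ⟨lam, hm, hlam⟩ := exists_measurable_minimal_state (exists_isState (ν := ν) (k := k))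
    (H := fun ω => energy (h ω) Λ) fun φ => by
      simp only [energy, map_sum]
      exact Finset.measurable_sum _ fun Z _ => hh.measurable Z φ
  refine ⟨lam, hm, ?_⟩
  filter_upwards [ae_isInteraction hh] with ω hω
  exact isLocalGroundState_of_minimal (fun Z => (hω Z).1) (hlam ω).1 (hlam ω).2

end Random

end QuantumSpin

end

theorem mainTheorem8 {ν k : ℕ} [NeZero k] {Ω : Type*} [MeasurableSpace Ω] (P : Measure Ω)
    [IsProbabilityMeasure P] (F : ℝ → ℝ) (hF : QuantumSpin.IsFFunction ν F)
    (h : Ω → Finset (QuantumSpin.Site ν) → QuantumSpin.Obs ν k)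
    (hh : QuantumSpin.IsErgodicInteraction P h)
    (Λ : ℕ → Finset (QuantumSpin.Site ν)) (hΛ : QuantumSpin.IsIAS Λ) :
    (∀ ω, QuantumSpin.IsInteraction (h ω) → QuantumSpin.fNorm F (h ω) < ∞ →
      ∀ lam : ℕ → WeakDual ℂ (QuantumSpin.Obs ν k),
        (∀ n, QuantumSpin.IsLocalGroundState (h ω) (Λ n) (lam n)) →
        ∀ φ : WeakDual ℂ (QuantumSpin.Obs ν k), MapClusterPt φ atTop lam →
          QuantumSpin.IsBulkGroundState (h ω) φ) ∧
    (0 < P {ω | QuantumSpin.fNorm F (h ω) < ∞} →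
      (∀ lam : ℕ → Ω → WeakDual ℂ (QuantumSpin.Obs ν k),
        (∀ n, QuantumSpin.IsWeakStarMeasurable (lam n)) →
        (∀ n, ∀ᵐ ω ∂P, QuantumSpin.IsLocalGroundState (h ω) (Λ n) (lam n ω)) →
        ∃ (Γ : Ω → WeakDual ℂ (QuantumSpin.Obs ν k)) (σ : ℕ → Ω → ℕ),
          QuantumSpin.IsDisorderedGroundState P h Γ ∧
          (∀ n, Measurable (σ n)) ∧
          ∀ᵐ ω ∂P, StrictMono (fun n => σ n ω) ∧
            Tendsto (fun n => lam (σ n ω) ω) atTop (𝓝 (Γ ω)) ∧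
            QuantumSpin.IsBulkGroundState (h ω) (Γ ω)) ∧
      ∃ Γ : Ω → WeakDual ℂ (QuantumSpin.Obs ν k),
        QuantumSpin.IsDisorderedGroundState P h Γ ∧
        ∀ᵐ ω ∂P, QuantumSpin.IsBulkGroundState (h ω) (Γ ω)) := by
  refine ⟨fun ω hω hfin lam hlam φ hφ =>
    QuantumSpin.isBulkGroundState_of_mapClusterPt hF hω hfin hΛ hlam hφ, fun hpos =>
    ⟨fun lam hmeas hlam => QuantumSpin.exists_disordered_groundState hF hh hΛ hpos lam hmeas hlam,
      ?_⟩⟩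
  -- Existence follows from the selection statement applied to measurable energy minimisers in each
  -- `Λ n`.
  choose lam hmeas hlam using fun n =>
    QuantumSpin.exists_measurable_local_groundStates hh.1 (Λ n)
  obtain ⟨Γ, σ, hΓ, -, hσ⟩ :=
    QuantumSpin.exists_disordered_groundState hF hh hΛ hpos lam hmeas hlam
  exact ⟨Γ, hΓ, hσ.mono fun ω hω => hω.2.2⟩
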